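/- Let $n\ge 0$, $\varepsilon>0$, let $V_0:\mathbb R^n\to\mathbb R$ be smooth with all derivatives of at most polynomial growth, and let $e:[0,\infty)\to\mathbb R^n$ be continuously differentiable. On the Schwartz space $\mathcal S(\mathbb R^n;\mathbb C)$ put $$\mathcal A(\tau)=\mathrm i\varepsilon\Delta-\mathrm i\varepsilon^{-1}\bigl(V_0(x)+e(\tau)^\top x\bigr).$$ For $t\ge 0$, $h>0$ let $\Theta_4=\Theta_4(t+h,t)$ be the sixth-order (power-truncated) Magnus expansion, with $\mathcal A_\zeta:=\mathcal A(t+\zeta)$ etc. and with integrals taken pointwise after application to a Schwartz function: $$\begin{aligned}\Theta_4={}&\int_0^h\!\mathcal A_\zeta\,d\zeta-\tfrac12\int_0^h\!\!\int_0^\zeta[\mathcal A_\xi,\mathcal A_\zeta]\,d\xi\,d\zeta +\tfrac1{12}\int_0^h\!\!\int_0^\zeta\!\!\int_0^\zeta[\mathcal A_\xi,[\mathcal A_\chi,\mathcal A_\zeta]]\,d\chi\,d\xi\,d\zeta\\ &+\tfrac14\int_0^h\!\!\int_0^\zeta\!\!\int_0^\xi[[\mathcal A_\chi,\mathcal A_\xi],\mathcal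 A_\zeta]\,d\chi\,d\xi\,d\zeta -\tfrac1{24}\int_0^h\!\!\int_0^\zeta\!\!\int_0^\zeta\!\!\int_0^\chi[\mathcal A_\xi,[[\mathcal A_\nu,\mathcal A_\chi],\mathcal A_\zeta]]\,d\nu\,d\chi\,d\xi\,d\zeta\\ &-\tfrac1{24}\int_0^h\!\!\int_0^\zeta\!\!\int_0^\xi\!\!\int_0^\xi[[\mathcal A_\chi,[\mathcal A_\nu,\mathcal A_\xi]],\mathcal A_\zeta]\,d\nu\,d\chi\,d\xi\,d\zeta -\tfrac18\int_0^h\!\!\int_0^\zeta\!\!\int_0^\xi\!\!\int_0^\chi[[[\mathcal A_\nu,\mathcal A_\chi],\mathcal A_\xi],\mathcal A_\zeta]\,d\nu\,d\chi\,d\xi\,d\zeta .\end{aligned}$$ Let $\mu_k=\int_0^h h^kB_k(\zeta/h)\,e(t+\zeta)\,d\zeta$ with $B_k$ the Bernoulli polynomials, $r=h^{-1}\mu_0$, $s=2\mu_1$, $q=\mu_2$, $p=\tfrac13\mu_3$, $$c=\mathrm i\varepsilon^{-1}\Bigl(2\int_0^h\!\zeta\, e(t+\zeta)^\top\!\int_0^\zeta\!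 e(t+\xi)\,d\xi\,d\zeta-\Bigl(\int_0^h\! e(t+\zeta)\,d\zeta\Bigr)^{\!\top}\!\int_0^h\!\zeta e(t+\zeta)\,d\zeta-\tfrac h6\Bigl|\int_0^h\! e(t+\zeta)\,d\zeta\Bigr|^2\Bigr),$$ and $$T_1=\mathrm i h\varepsilon\Delta-s^\top\nabla,\qquad W_1=-\mathrm i h\varepsilon^{-1}(V_0+r^\top x)+\mathrm i\varepsilon^{-1}q^\top\nabla V_0+c,\qquad C_1=[\Delta,\,p^\top\nabla V_0].$$ For an operator $A$ on $\mathcal S(\mathbb R^n;\mathbb C)$, an exponential $\mathrm e^{A}$ is the time-one map of a strongly continuous unitary group on $L^2(\mathbb R^n)$ whose generator extends $A$ (if the closure of $A$ is skew-adjoint, there is exactly one). Then: 1. $\Theta_4=T_1+W_1+C_1$ on $\mathcal S(\mathbb R^n;\mathbb C)$ for all $t\ge0$, $h>0$. 2. For every $u\in\mathcal S(\mathbb R^n;\mathbb C)$ and $T\in\mathbb R$ there are constants $K$ and $h_0>0$ such that for all $t\in[0,T]$ and $0<h<h_0$: $\|C_1u\|_{L^2}\le Kh^5$ (that is, $C_1=O(h^5)$),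 and, for all exponentials $\mathrm e^{\Theta_4}$, $\mathrm e^{T_1+W_1}$, $\mathrm e^{\frac12C_1}$, $$\bigl\|\mathrm e^{\Theta_4}u-\mathrm e^{\frac12C_1}\mathrm e^{T_1+W_1}\mathrm e^{\frac12C_1}u\bigr\|_{L^2}\le K h^7 .$$ That is, $\mathrm e^{\Theta_4}=\mathrm e^{\frac12C_1}\mathrm e^{T_1+W_1}\mathrm e^{\frac12C_1}+O(h^7)$: the Strang splitting is of order six. -/

import Mathlib

open MeasureTheory SchwartzMap
open scoped LineDeriv Laplacian Gradient ContDiff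

noncomputable section

namespace LaserMagnus

/-- The space `ℝⁿ`. -/
abbrev Space (n : ℕ) : Type := EuclideanSpace ℝ (Fin n)

/-- The Hilbert space `L²(ℝⁿ; ℂ)`. -/
abbrev L2 (n : ℕ) : Type := Lp ℂ 2 (volume : Measure (Space n))

/-- Continuous linear operators on the Schwartz space `𝓢(ℝⁿ; ℂ)`. They form a ring, and
`⁅A, B⁆ = A * B - B * A` is the commutator. -/
abbrev Op (n : ℕ) : Type := 𝓢(Space n, ℂ) →L[ℂ] 𝓢(Space n, ℂ)

variable {n : ℕ}

/-- The Laplacian `Δ`. -/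
def lap : Op n := LineDeriv.laplacianCLM ℂ (Space n) 𝓢(Space n, ℂ)

/-- The directional derivative `aᵀ∇`. -/
def dirDeriv (a : Space n) : Op n := LineDeriv.lineDerivOpCLM ℂ 𝓢(Space n, ℂ) a

/-- Multiplication by `g` (used for smooth `g` of at most polynomial growth, with all its
derivatives). -/
def mulOp (g : Space n → ℂ) : Op n := SchwartzMap.smulLeftCLM ℂ g

/-- The operator `𝒜(τ) = iεΔ - iε⁻¹ (V₀(x) + e(τ)ᵀx)`. -/
def schrOp (ε : ℝ) (V₀ : Space n → ℝ) (e : ℝ → Space n) (τ : ℝ) : Op n :=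
  (Complex.I * (ε : ℂ)) • lap
    - (Complex.I * (ε : ℂ)⁻¹) • mulOp (fun x => ((V₀ x + inner ℝ (e τ) x : ℝ) : ℂ))

section Magnus

/-! The terms of the power-truncated Magnus expansion for a family of operators `A`, on the step
from `t` to `t + h`. An integral of operators is applied to a Schwartz function `u` and evaluated
at a point `x`. -/

variable (A : ℝ → Op n) (t h : ℝ) (u : 𝓢(Space n, ℂ)) (x : Space n)

/-- `Θ^[1]`. -/
def theta1 : ℂ := ∫ ζ in (0 : ℝ)..h, (A (t + ζ) u) x

/-- `Θ^[2]`. -/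
def theta2 : ℂ :=
  -(1 / 2) * ∫ ζ in (0 : ℝ)..h, ∫ ξ in (0 : ℝ)..ζ, (⁅A (t + ξ), A (t + ζ)⁆ u) x

/-- `Θ^[3,1]`. -/
def theta31 : ℂ :=
  (1 / 12) * ∫ ζ in (0 : ℝ)..h, ∫ ξ in (0 : ℝ)..ζ, ∫ χ in (0 : ℝ)..ζ,
    (⁅A (t + ξ), ⁅A (t + χ), A (t + ζ)⁆⁆ u) x

/-- `Θ^[3,2]`. -/
def theta32 : ℂ :=
  (1 / 4) * ∫ ζ in (0 : ℝ)..h, ∫ ξ in (0 : ℝ)..ζ, ∫ χ in (0 : ℝ)..ξ,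
    (⁅⁅A (t + χ), A (t + ξ)⁆, A (t + ζ)⁆ u) x

/-- `Θ^[4,1]`. -/
def theta41 : ℂ :=
  -(1 / 24) * ∫ ζ in (0 : ℝ)..h, ∫ ξ in (0 : ℝ)..ζ, ∫ χ in (0 : ℝ)..ζ, ∫ ν in (0 : ℝ)..χ,
    (⁅A (t + ξ), ⁅⁅A (t + ν), A (t + χ)⁆, A (t + ζ)⁆⁆ u) x

/-- `Θ^[4,2]`. -/
def theta42 : ℂ :=
  -(1 / 24) * ∫ ζ in (0 : ℝ)..h, ∫ ξ in (0 : ℝ)..ζ, ∫ χ in (0 : ℝ)..ξ, ∫ ν in (0 : ℝ)..ξ,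
    (⁅⁅A (t + χ), ⁅A (t + ν), A (t + ξ)⁆⁆, A (t + ζ)⁆ u) x

/-- `Θ^[4,3]`. -/
def theta43 : ℂ :=
  -(1 / 8) * ∫ ζ in (0 : ℝ)..h, ∫ ξ in (0 : ℝ)..ζ, ∫ χ in (0 : ℝ)..ξ, ∫ ν in (0 : ℝ)..χ,
    (⁅⁅⁅A (t + ν), A (t + χ)⁆, A (t + ξ)⁆, A (t + ζ)⁆ u) x

/-- The sixth-order Magnus expansion `Θ₄(t+h,t)`, applied to `u` and evaluated at `x`. -/
def Theta4 : ℂ :=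
  theta1 A t h u x + theta2 A t h u x + theta31 A t h u x + theta32 A t h u x
    + theta41 A t h u x + theta42 A t h u x + theta43 A t h u x

end Magnus

/-- The rescaled Bernoulli polynomial `B̃ₖ(h, ζ) = hᵏ Bₖ(ζ / h)`. -/
def rescaledBernoulli (k : ℕ) (h ζ : ℝ) : ℝ :=
  h ^ k * Polynomial.aeval (ζ / h) (Polynomial.bernoulli k)

/-- `μₖ(t,h) = ∫₀ʰ B̃ₖ(h,ζ) e(t+ζ) dζ`. -/
def mu (e : ℝ → Space n) (k : ℕ) (t h : ℝ) : Space n :=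
  ∫ ζ in (0 : ℝ)..h, rescaledBernoulli k h ζ • e (t + ζ)

/-- `r = h⁻¹ μ₀`. -/
def rVec (e : ℝ → Space n) (t h : ℝ) : Space n := h⁻¹ • mu e 0 t h

/-- `s = 2 μ₁`. -/
def sVec (e : ℝ → Space n) (t h : ℝ) : Space n := (2 : ℝ) • mu e 1 t h

/-- `q = μ₂`. -/
def qVec (e : ℝ → Space n) (t h : ℝ) : Space n := mu e 2 t h

/-- `p = μ₃ / 3`. -/
def pVec (e : ℝ → Space n) (t h : ℝ) : Space n := (1 / 3 : ℝ) • mu e 3 t h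

/-- The scalar `c(t,h)`. -/
def cScalar (ε : ℝ) (e : ℝ → Space n) (t h : ℝ) : ℂ :=
  Complex.I * (ε : ℂ)⁻¹ *
    ((2 * (∫ ζ in (0 : ℝ)..h, ζ * inner ℝ (e (t + ζ)) (∫ ξ in (0 : ℝ)..ζ, e (t + ξ)))
      - inner ℝ (∫ ζ in (0 : ℝ)..h, e (t + ζ)) (∫ ζ in (0 : ℝ)..h, ζ • e (t + ζ))
      - 1 / 6 * h * ‖∫ ζ in (0 : ℝ)..h, e (t + ζ)‖ ^ 2 : ℝ) : ℂ)

/-- `T₁ = ihεΔ - sᵀ∇`. -/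
def T1 (ε : ℝ) (e : ℝ → Space n) (t h : ℝ) : Op n :=
  (Complex.I * (h : ℂ) * (ε : ℂ)) • lap - dirDeriv (sVec e t h)

/-- `W₁ = -ihε⁻¹ (V₀(x) + rᵀx) + iε⁻¹ qᵀ∇V₀ + c`, a multiplication operator. -/
def W1 (ε : ℝ) (V₀ : Space n → ℝ) (e : ℝ → Space n) (t h : ℝ) : Op n :=
  mulOp (fun x =>
    -(Complex.I * (h : ℂ) * (ε : ℂ)⁻¹) * ((V₀ x + inner ℝ (rVec e t h) x : ℝ) : ℂ)
      + Complex.I * (ε : ℂ)⁻¹ * ((inner ℝ (qVec e t h) (∇ V₀ x) : ℝ) : ℂ)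
      + cScalar ε e t h)

/-- `C₁ = [Δ, pᵀ∇V₀]`, the commutator of the Laplacian with multiplication by `pᵀ∇V₀`. -/
def C1 (V₀ : Space n → ℝ) (e : ℝ → Space n) (t h : ℝ) : Op n :=
  ⁅(lap : Op n), mulOp (fun x => ((inner ℝ (pVec e t h) (∇ V₀ x) : ℝ) : ℂ))⁆

/-- `S` is a strongly continuous one-parameter group of unitary operators on `L²(ℝⁿ)`. -/
structure IsUnitaryGroup (S : ℝ → (L2 n ≃ₗᵢ[ℂ] L2 n)) : Prop where
  map_zero : ∀ f, S 0 f = f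
  map_add : ∀ σ τ f, S (σ + τ) f = S σ (S τ f)
  continuous : ∀ f, Continuous (fun τ => S τ f)

/-- `U = e^A`: the operator `U` is the time-one map of a strongly continuous unitary group on
`L²(ℝⁿ)` whose generator extends the operator `A`, given on Schwartz functions. (If the closure of
`A` is skew-adjoint, there is exactly one such `U`.) -/
def IsExp (A : 𝓢(Space n, ℂ) → Space n → ℂ) (U : L2 n ≃ₗᵢ[ℂ] L2 n) : Prop :=
  ∃ S : ℝ → (L2 n ≃ₗᵢ[ℂ] L2 n), IsUnitaryGroup S ∧
    (∀ u : 𝓢(Space n, ℂ), ∃ g : L2 n, (g : Space n → ℂ) =ᵐ[volume] A u ∧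
      HasDerivAt (fun τ : ℝ => S τ (u.toLp 2)) g 0) ∧
    S 1 = U

end LaserMagnus

end

/-! The operators `schrOp ε V₀ e τ` differ only in the linear potential, so nested commutators
collapse. Depth two leaves only the commutator of `Δ` with a linear function, a constant-coefficient
field `dᵀ∇` with `d = 2(e(τ) - e(σ))`. Bracketing once more gives multiplication by `dᵀ∇V₀` plus a
scalar, and once again gives `-[Δ, dᵀ∇V₀]`, independent of the two outer times
(`schrOp_lie_lie_dirDeriv`). Hence the iterated integrals reduce to moments of `e`, plus one
quadratic integral that ends up in `c`. Integration by parts (`integral_pow_smul_moment`) evaluates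
them, and the combinations that appear are the Bernoulli moments. This gives `Theta4_eq`.

For the splitting, write `B = T₁ + W₁` and `C = C₁`. Then `B = O(h)`. Since `B₃` has mean zero and
`e` is Lipschitz on compact intervals, `μ₃ = O(h⁵)`, so `C = O(h⁵)` (`norm_mu_three_le`). The
exponentials are unitary, so on Schwartz functions the Taylor remainder of degree `m` is bounded by
`‖Aᵐu‖` (`IsExp.norm_sub_expPoly_le`). No domain question arises, because Schwartz space is
invariant under all the operators. What remains is algebra: the Taylor polynomials of both sides
agree in `C` and in `(BC + CB)/2`. Each leftover term contains `C` together with two further factors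
of `B`, or contains `C` twice, so it is `O(h⁷)` (`expPoly_sub_strangPoly_eq`, `strang_splitting`).
-/

namespace LaserMagnus

/-! ### Commutators of the Laplacian, directional derivatives and multiplication operators. -/

section Operators

variable {n : ℕ}

/-- The gradient of a function of temperate growth has temperate growth, in each direction. -/
theorem hasTemperateGrowth_inner_gradient {V : Space n → ℝ} (hV : V.HasTemperateGrowth)
    (a : Space n) : (fun x => inner ℝ a (∇ V x)).HasTemperateGrowth := by
  have hfd : (fderiv ℝ V).HasTemperateGrowth := by
    refine ⟨hV.1.fderiv_right (by simp), fun m => ?_⟩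
    obtain ⟨k, C, h⟩ := hV.2 (m + 1)
    exact ⟨k, C, fun x => by rw [norm_iteratedFDeriv_fderiv]; exact h x⟩
  have h : (fun x => inner ℝ a (∇ V x)) = (ContinuousLinearMap.apply ℝ ℝ a) ∘ fderiv ℝ V := by
    funext x
    simp [inner_gradient_right]
  rw [h]
  exact (ContinuousLinearMap.hasTemperateGrowth _).comp hfd

theorem hasTemperateGrowth_ofReal {f : Space n → ℝ} (hf : f.HasTemperateGrowth) :
    (fun x => (f x : ℂ)).HasTemperateGrowth :=
  Function.Complex.hasTemperateGrowth_ofReal.comp hf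

theorem op_mul_apply (A B : Op n) (u : 𝓢(Space n, ℂ)) : (A * B) u = A (B u) := rfl

theorem mulOp_apply {g : Space n → ℂ} (hg : g.HasTemperateGrowth) (u : 𝓢(Space n, ℂ))
    (x : Space n) : mulOp g u x = g x * u x := by
  simp [mulOp, smulLeftCLM_apply_apply hg]

theorem dirDeriv_apply (a : Space n) (u : 𝓢(Space n, ℂ)) (x : Space n) :
    dirDeriv a u x = fderiv ℝ u x a := rfl

theorem dirDeriv_add (a b : Space n) : dirDeriv (a + b) = dirDeriv a + dirDeriv b := by
  ext u x
  simp [dirDeriv_apply]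

theorem dirDeriv_sub (a b : Space n) : dirDeriv (a - b) = dirDeriv a - dirDeriv b := by
  ext u x
  simp [dirDeriv_apply]

theorem dirDeriv_smul (c : ℝ) (a : Space n) : dirDeriv (c • a) = (c : ℂ) • dirDeriv a := by
  ext u x
  simp [dirDeriv_apply]

theorem lap_eq_sum : (lap : Op n) =
    ∑ i, dirDeriv (EuclideanSpace.basisFun (Fin n) ℝ i)
      * dirDeriv (EuclideanSpace.basisFun (Fin n) ℝ i) := by
  ext1 u
  rw [lap, laplacianCLM_eq, laplacian_eq_sum (EuclideanSpace.basisFun (Fin n) ℝ)]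
  simp [dirDeriv]

/-- Symmetry of the second derivative of a smooth function. -/
theorem dirDeriv_commute (a b : Space n) : dirDeriv a * dirDeriv b = dirDeriv b * dirDeriv a := by
  ext u x
  have h : ∀ a b : Space n, (dirDeriv a * dirDeriv b) u x = (iteratedFDeriv ℝ 2 u x) ![a, b] := by
    intro a b
    rw [← iteratedLineDerivOp_eq_iteratedFDeriv]
    rfl
  rw [h, h]
  have hs : IsSymmSndFDerivAt ℝ u x :=
    ContDiffAt.isSymmSndFDerivAt (n := 2) (u.smooth 2).contDiffAt (by simp)
  rw [iteratedFDeriv_two_apply, iteratedFDeriv_two_apply]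
  exact hs a b

/-- Multiplication by `aᵀx`. -/
noncomputable def linOp (a : Space n) : Op n := mulOp (fun x => ((inner ℝ a x : ℝ) : ℂ))

/-- Multiplication by `aᵀ∇V`. -/
noncomputable def gradOp (V : Space n → ℝ) (a : Space n) : Op n :=
  mulOp (fun x => ((inner ℝ a (∇ V x) : ℝ) : ℂ))

theorem linOp_apply (a : Space n) (u : 𝓢(Space n, ℂ)) (x : Space n) :
    linOp a u x = (inner ℝ a x : ℝ) * u x :=
  mulOp_apply (hasTemperateGrowth_ofReal (by fun_prop)) u x

theorem gradOp_apply {V : Space n → ℝ} (hV : V.HasTemperateGrowth) (a : Space n)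
    (u : 𝓢(Space n, ℂ)) (x : Space n) :
    gradOp V a u x = (inner ℝ a (∇ V x) : ℝ) * u x :=
  mulOp_apply (hasTemperateGrowth_ofReal (hasTemperateGrowth_inner_gradient hV a)) u x

/-- The commutator of a multiplication operator with a directional derivative. -/
theorem mulOp_lie_dirDeriv {f : Space n → ℝ} (hf : f.HasTemperateGrowth) (a : Space n) :
    mulOp (fun x => (f x : ℂ)) * dirDeriv a - dirDeriv a * mulOp (fun x => (f x : ℂ))
      = -gradOp f a := by
  ext u x
  have hf' := hasTemperateGrowth_ofReal hf
  have hd : HasFDerivAt f (fderiv ℝ f x) x :=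
    (hf.1.differentiable (by simp)).differentiableAt.hasFDerivAt
  have h1 : HasFDerivAt (fun x => (f x : ℂ)) (Complex.ofRealCLM.comp (fderiv ℝ f x)) x :=
    Complex.ofRealCLM.hasFDerivAt.comp x hd
  have h2 : HasFDerivAt (fun x => (f x : ℂ) * u x) _ x := h1.mul (u.hasFDerivAt x)
  have h3 : (mulOp (fun x => (f x : ℂ)) u : Space n → ℂ) = fun x => (f x : ℂ) * u x :=
    funext fun x => mulOp_apply hf' u x
  have h4 : dirDeriv a (mulOp (fun x => (f x : ℂ)) u) x
      = f x * fderiv ℝ u x a + u x * (fderiv ℝ f x a : ℝ) := by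
    rw [dirDeriv_apply, h3, h2.fderiv]
    simp
  have h5 : (mulOp (fun x => (f x : ℂ)) * dirDeriv a - dirDeriv a * mulOp (fun x => (f x : ℂ))) u x
      = mulOp (fun x => (f x : ℂ)) (dirDeriv a u) x - dirDeriv a (mulOp (fun x => (f x : ℂ)) u) x :=
    rfl
  have h6 : (-gradOp f a) u x = -(gradOp f a u x) := rfl
  rw [h5, h6, h4, mulOp_apply hf', gradOp_apply hf, dirDeriv_apply, inner_gradient_right]
  simp
  ring

theorem gradient_inner (a x : Space n) : ∇ (fun y : Space n => inner ℝ a y) x = a := by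
  refine HasGradientAt.gradient ?_
  rw [hasGradientAt_iff_hasFDerivAt]
  exact ((innerSL ℝ) a).hasFDerivAt

/-- The product rule for a linear factor, whose gradient is the constant `a`. -/
theorem dirDeriv_mul_linOp (a b : Space n) :
    dirDeriv b * linOp a = linOp a * dirDeriv b + ((inner ℝ b a : ℝ) : ℂ) • 1 := by
  have h := mulOp_lie_dirDeriv (f := fun y : Space n => inner ℝ a y) (by fun_prop) b
  have h' : gradOp (fun y : Space n => inner ℝ a y) b = ((inner ℝ b a : ℝ) : ℂ) • (1 : Op n) := by
    ext u x
    rw [gradOp_apply (by fun_prop), gradient_inner]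
    simp
  rw [h', sub_eq_iff_eq_add] at h
  change linOp a * dirDeriv b = _ + dirDeriv b * linOp a at h
  rw [h]
  module

/-- `[Δ, aᵀx] = 2aᵀ∇`. -/
theorem lap_mul_linOp (a : Space n) :
    lap * linOp a = linOp a * lap + (2 : ℂ) • dirDeriv a := by
  set b := EuclideanSpace.basisFun (Fin n) ℝ
  have ha : dirDeriv a = ∑ i, ((inner ℝ (b i) a : ℝ) : ℂ) • dirDeriv (b i) := by
    ext u x
    conv_lhs => rw [← b.sum_repr' a]
    simp [dirDeriv_apply]
  rw [lap_eq_sum, ha, Finset.sum_mul, Finset.mul_sum, Finset.smul_sum, ← Finset.sum_add_distrib]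
  refine Finset.sum_congr rfl fun i _ => ?_
  -- Moving both factors of `∂ᵢ²` past `aᵀx` produces `aᵢ∂ᵢ` twice, hence the factor `2`.
  rw [mul_assoc, dirDeriv_mul_linOp, mul_add, ← mul_assoc, dirDeriv_mul_linOp, add_mul, mul_assoc]
  simp only [smul_mul_assoc, mul_smul_comm, one_mul, mul_one]
  module

theorem lap_commute_dirDeriv (a : Space n) : lap * dirDeriv a = dirDeriv a * lap := by
  rw [lap_eq_sum, Finset.sum_mul, Finset.mul_sum]
  refine Finset.sum_congr rfl fun i _ => ?_
  rw [mul_assoc, dirDeriv_commute _ a, ← mul_assoc, dirDeriv_commute _ a, mul_assoc]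

theorem mulOp_commute {f g : Space n → ℂ} (hf : f.HasTemperateGrowth) (hg : g.HasTemperateGrowth) :
    mulOp f * mulOp g = mulOp g * mulOp f := by
  ext u x
  simp only [op_mul_apply, mulOp_apply hf, mulOp_apply hg]
  ring

theorem gradOp_add {V : Space n → ℝ} (hV : V.HasTemperateGrowth) (a b : Space n) :
    gradOp V (a + b) = gradOp V a + gradOp V b := by
  ext u x
  simp [gradOp_apply hV, add_mul]

theorem gradOp_smul {V : Space n → ℝ} (hV : V.HasTemperateGrowth) (c : ℝ) (a : Space n) :
    gradOp V (c • a) = (c : ℂ) • gradOp V a := by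
  ext u x
  simp [gradOp_apply hV, mul_assoc]

theorem linOp_add (a b : Space n) : linOp (a + b) = linOp a + linOp b := by
  ext u x
  simp [linOp_apply, inner_add_left, add_mul]

theorem linOp_smul (c : ℝ) (a : Space n) : linOp (c • a) = (c : ℂ) • linOp a := by
  ext u x
  simp [linOp_apply, inner_smul_left, mul_assoc]

variable {ε : ℝ} {V₀ : Space n → ℝ} (e : ℝ → Space n)

theorem schrOp_eq (hV₀ : V₀.HasTemperateGrowth) (ε τ : ℝ) :
    schrOp ε V₀ e τ = (Complex.I * (ε : ℂ)) • lap
      - (Complex.I * (ε : ℂ)⁻¹) • (mulOp (fun x => (V₀ x : ℂ)) + linOp (e τ)) := by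
  have h : mulOp (fun x => ((V₀ x + inner ℝ (e τ) x : ℝ) : ℂ))
      = mulOp (fun x => (V₀ x : ℂ)) + linOp (e τ) := by
    ext u x
    rw [mulOp_apply (hasTemperateGrowth_ofReal (f := fun x => V₀ x + inner ℝ (e τ) x)
      (hV₀.add (by fun_prop)))]
    simp [mulOp_apply (hasTemperateGrowth_ofReal hV₀), linOp_apply, add_mul]
  rw [schrOp, h]

/-- `V₀` and `Δ` are common to both operators and the potentials commute, so only `[Δ, (e(τ) -
e(σ))ᵀx]` survives; its coefficient is `(iε)(-iε⁻¹) = 1`. -/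
theorem schrOp_lie_schrOp (hε : ε ≠ 0) (hV₀ : V₀.HasTemperateGrowth) (σ τ : ℝ) :
    ⁅schrOp ε V₀ e σ, schrOp ε V₀ e τ⁆ = dirDeriv ((2 : ℝ) • (e τ - e σ)) := by
  have hc : mulOp (fun x => (V₀ x : ℂ)) * linOp (e σ) = linOp (e σ) * mulOp (fun x => (V₀ x : ℂ)) :=
    mulOp_commute (hasTemperateGrowth_ofReal hV₀) (hasTemperateGrowth_ofReal (by fun_prop))
  have hc' : mulOp (fun x => (V₀ x : ℂ)) * linOp (e τ) = linOp (e τ) * mulOp (fun x => (V₀ x : ℂ)) :=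
    mulOp_commute (hasTemperateGrowth_ofReal hV₀) (hasTemperateGrowth_ofReal (by fun_prop))
  have hl : linOp (e σ) * linOp (e τ) = linOp (e τ) * linOp (e σ) :=
    mulOp_commute (hasTemperateGrowth_ofReal (by fun_prop)) (hasTemperateGrowth_ofReal (by fun_prop))
  have hε' : (ε : ℂ) ≠ 0 := by exact_mod_cast hε
  rw [Ring.lie_def, schrOp_eq e hV₀, schrOp_eq e hV₀, dirDeriv_smul, dirDeriv_sub]
  simp only [sub_mul, mul_sub, add_mul, mul_add, smul_mul_assoc, mul_smul_comm, lap_mul_linOp, hc,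
    hc', hl]
  match_scalars <;> field_simp <;> simp

/-- `Δ` commutes with `dᵀ∇`, so only the derivative of the potential along `d` is left. -/
theorem schrOp_lie_dirDeriv (hV₀ : V₀.HasTemperateGrowth) (τ : ℝ) (d : Space n) :
    ⁅schrOp ε V₀ e τ, dirDeriv d⁆ = (Complex.I * (ε : ℂ)⁻¹) •
      (gradOp V₀ d + ((inner ℝ d (e τ) : ℝ) : ℂ) • 1) := by
  have hc : mulOp (fun x => (V₀ x : ℂ)) * dirDeriv d
      = dirDeriv d * mulOp (fun x => (V₀ x : ℂ)) - gradOp V₀ d := by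
    rw [sub_eq_add_neg, ← mulOp_lie_dirDeriv hV₀ d]
    abel
  rw [Ring.lie_def, schrOp_eq e hV₀]
  simp only [sub_mul, mul_sub, add_mul, mul_add, smul_mul_assoc, mul_smul_comm, hc,
    dirDeriv_mul_linOp, lap_commute_dirDeriv]
  module

/-- The potential is a multiplication operator and drops out, and with it the dependence on `τ`. -/
theorem schrOp_lie_gradOp (hV₀ : V₀.HasTemperateGrowth) (τ : ℝ) (d : Space n) :
    ⁅schrOp ε V₀ e τ, gradOp V₀ d⁆ = (Complex.I * (ε : ℂ)) • ⁅(lap : Op n), gradOp V₀ d⁆ := by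
  have hg := hasTemperateGrowth_ofReal (hasTemperateGrowth_inner_gradient hV₀ d)
  have hc : mulOp (fun x => (V₀ x : ℂ)) * gradOp V₀ d = gradOp V₀ d * mulOp (fun x => (V₀ x : ℂ)) :=
    mulOp_commute (hasTemperateGrowth_ofReal hV₀) hg
  have hl : linOp (e τ) * gradOp V₀ d = gradOp V₀ d * linOp (e τ) :=
    mulOp_commute (hasTemperateGrowth_ofReal (by fun_prop)) hg
  rw [Ring.lie_def, Ring.lie_def, schrOp_eq e hV₀]
  simp only [sub_mul, mul_sub, add_mul, mul_add, smul_mul_assoc, mul_smul_comm, hc, hl]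
  module

end Operators

/-! ### Iterated integrals as moments. -/

section Moments

variable {E : Type*} [NormedAddCommGroup E] [NormedSpace ℝ E]

/-- The moment `∫₀ᶻ sᵏ g(s) ds`. -/
noncomputable def moment (g : ℝ → E) (k : ℕ) (z : ℝ) : E := ∫ s in (0 : ℝ)..z, s ^ k • g s

variable {g : ℝ → E}

@[simp] theorem moment_zero_right (g : ℝ → E) (k : ℕ) : moment g k 0 = 0 := by
  simp [moment]

variable [CompleteSpace E]

theorem hasDerivAt_moment (hg : Continuous g) (k : ℕ) (z : ℝ) :
    HasDerivAt (moment g k) (z ^ k • g z) z :=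
  intervalIntegral.integral_hasDerivAt_right (Continuous.intervalIntegrable (by fun_prop) _ _)
    (Continuous.stronglyMeasurableAtFilter (by fun_prop) _ _) (by fun_prop)

theorem continuous_moment (hg : Continuous g) (k : ℕ) : Continuous (moment g k) :=
  continuous_iff_continuousAt.2 fun z => (hasDerivAt_moment hg k z).continuousAt

/-- Integration by parts: `s ^ j` is integrated and the moment is differentiated. The iterated
integrals that follow are linear combinations of instances of this formula. -/
theorem integral_pow_smul_moment (hg : Continuous g) (j k : ℕ) (h : ℝ) :
    ∫ s in (0 : ℝ)..h, s ^ j • moment g k s =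
      ((j : ℝ) + 1)⁻¹ • (h ^ (j + 1) • moment g k h - moment g (j + k + 1) h) := by
  have hc := continuous_moment hg k
  have hd : ∀ s, HasDerivAt (fun s => ((j : ℝ) + 1)⁻¹ • (s ^ (j + 1) • moment g k s
      - moment g (j + k + 1) s)) (s ^ j • moment g k s) s := by
    intro s
    have := (((hasDerivAt_pow (j + 1) s).smul (hasDerivAt_moment hg k s)).sub
      (hasDerivAt_moment hg (j + k + 1) s)).const_smul (((j : ℝ) + 1)⁻¹)
    refine this.congr_deriv ?_
    have hj : (j : ℝ) + 1 ≠ 0 := by positivity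
    match_scalars <;> push_cast <;> field_simp <;> simp <;> ring
  rw [intervalIntegral.integral_eq_sub_of_hasDerivAt (fun s _ => hd s)
    (Continuous.intervalIntegrable (by fun_prop) _ _)]
  simp

theorem integral_sub_const_left (hg : Continuous g) (z : ℝ) :
    ∫ s in (0 : ℝ)..z, (2 : ℝ) • (g z - g s) = (2 : ℝ) • (z • g z - moment g 0 z) := by
  rw [intervalIntegral.integral_smul, intervalIntegral.integral_sub (by simp)
    (hg.intervalIntegrable _ _)]
  simp [moment]

theorem integral_double_sub (hg : Continuous g) (z : ℝ) :
    ∫ s in (0 : ℝ)..z, (2 : ℝ) • (s • g s - moment g 0 s)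
      = (4 : ℝ) • moment g 1 z - (2 * z) • moment g 0 z := by
  have hc := continuous_moment hg 0
  have h1 := integral_pow_smul_moment hg 0 0 z
  have h2 : ∫ s in (0 : ℝ)..z, s • g s = moment g 1 z := by simp [moment]
  simp only [pow_zero, one_smul] at h1
  rw [intervalIntegral.integral_smul, intervalIntegral.integral_sub
    (Continuous.intervalIntegrable (by fun_prop) _ _)
    (Continuous.intervalIntegrable (by fun_prop) _ _), h1, h2]
  norm_num
  module

theorem integral_double_mul_sub (hg : Continuous g) (z : ℝ) :
    ∫ s in (0 : ℝ)..z, s • (2 : ℝ) • (s • g s - moment g 0 s)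
      = (3 : ℝ) • moment g 2 z - z ^ 2 • moment g 0 z := by
  have hc := continuous_moment hg 0
  have h1 := integral_pow_smul_moment hg 1 0 z
  have h2 : ∫ s in (0 : ℝ)..z, s ^ 2 • g s = moment g 2 z := rfl
  have h3 : ∀ s : ℝ, s • (2 : ℝ) • (s • g s - moment g 0 s)
      = (2 : ℝ) • (s ^ 2 • g s - s ^ 1 • moment g 0 s) := fun s => by module
  simp only [h3]
  rw [intervalIntegral.integral_smul, intervalIntegral.integral_sub
    (Continuous.intervalIntegrable (by fun_prop) _ _)
    (Continuous.intervalIntegrable (by fun_prop) _ _), h1, h2]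
  norm_num
  module

theorem integral_triple_sub (hg : Continuous g) (z : ℝ) :
    ∫ s in (0 : ℝ)..z, ((4 : ℝ) • moment g 1 s - (2 * s) • moment g 0 s)
      = (4 * z) • moment g 1 z - (3 : ℝ) • moment g 2 z - z ^ 2 • moment g 0 z := by
  have hc := continuous_moment hg 0
  have hc1 := continuous_moment hg 1
  have h1 := integral_pow_smul_moment hg 0 1 z
  have h2 := integral_pow_smul_moment hg 1 0 z
  have h3 : ∀ s : ℝ, (4 : ℝ) • moment g 1 s - (2 * s) • moment g 0 s
      = (4 : ℝ) • (s ^ 0 • moment g 1 s) - (2 : ℝ) • (s ^ 1 • moment g 0 s) := fun s => by module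
  simp only [h3]
  rw [intervalIntegral.integral_sub
    (Continuous.intervalIntegrable (by fun_prop) _ _)
    (Continuous.intervalIntegrable (by fun_prop) _ _), intervalIntegral.integral_smul,
    intervalIntegral.integral_smul, h1, h2]
  norm_num
  module

theorem integral_triple_mul_sub (hg : Continuous g) (z : ℝ) :
    ∫ s in (0 : ℝ)..z, s • ((4 : ℝ) • moment g 1 s - (2 * s) • moment g 0 s)
      = (2 * z ^ 2) • moment g 1 z - (4 / 3 : ℝ) • moment g 3 z - (2 / 3 * z ^ 3) • moment g 0 z := by
  have hc := continuous_moment hg 0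
  have hc1 := continuous_moment hg 1
  have h1 := integral_pow_smul_moment hg 1 1 z
  have h2 := integral_pow_smul_moment hg 2 0 z
  have h3 : ∀ s : ℝ, s • ((4 : ℝ) • moment g 1 s - (2 * s) • moment g 0 s)
      = (4 : ℝ) • (s ^ 1 • moment g 1 s) - (2 : ℝ) • (s ^ 2 • moment g 0 s) := fun s => by module
  simp only [h3]
  rw [intervalIntegral.integral_sub
    (Continuous.intervalIntegrable (by fun_prop) _ _)
    (Continuous.intervalIntegrable (by fun_prop) _ _), intervalIntegral.integral_smul,
    intervalIntegral.integral_smul, h1, h2]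
  norm_num
  module

theorem integral_three_sub (hg : Continuous g) (z : ℝ) :
    ∫ s in (0 : ℝ)..z, ((3 : ℝ) • moment g 2 s - s ^ 2 • moment g 0 s)
      = (3 * z) • moment g 2 z - (8 / 3 : ℝ) • moment g 3 z - (z ^ 3 / 3) • moment g 0 z := by
  have hc := continuous_moment hg 0
  have hc1 := continuous_moment hg 2
  have h1 := integral_pow_smul_moment hg 0 2 z
  have h2 := integral_pow_smul_moment hg 2 0 z
  have h3 : ∀ s : ℝ, (3 : ℝ) • moment g 2 s - s ^ 2 • moment g 0 s
      = (3 : ℝ) • (s ^ 0 • moment g 2 s) - s ^ 2 • moment g 0 s := fun s => by module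
  simp only [h3]
  rw [intervalIntegral.integral_sub
    (Continuous.intervalIntegrable (by fun_prop) _ _)
    (Continuous.intervalIntegrable (by fun_prop) _ _), intervalIntegral.integral_smul, h1, h2]
  norm_num
  module

theorem integral_four_sub (hg : Continuous g) (z : ℝ) :
    ∫ s in (0 : ℝ)..z, ((4 * s) • moment g 1 s - (3 : ℝ) • moment g 2 s - s ^ 2 • moment g 0 s)
      = (2 * z ^ 2) • moment g 1 z - (3 * z) • moment g 2 z + (4 / 3 : ℝ) • moment g 3 z
        - (z ^ 3 / 3) • moment g 0 z := by
  have hc := continuous_moment hg 0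
  have hc1 := continuous_moment hg 1
  have hc2 := continuous_moment hg 2
  have h1 := integral_pow_smul_moment hg 1 1 z
  have h2 := integral_three_sub hg z
  have h3 : ∀ s : ℝ, (4 * s) • moment g 1 s - (3 : ℝ) • moment g 2 s - s ^ 2 • moment g 0 s
      = (4 : ℝ) • (s ^ 1 • moment g 1 s) - (6 : ℝ) • (s ^ 0 • moment g 2 s)
        + ((3 : ℝ) • moment g 2 s - s ^ 2 • moment g 0 s) := fun s => by module
  -- The coefficient `-3` of the second moment is split as `-6 + 3`, so that the last group is the
  -- integrand of `integral_three_sub`.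
  simp only [h3]
  rw [intervalIntegral.integral_add
    (Continuous.intervalIntegrable (by fun_prop) _ _)
    (Continuous.intervalIntegrable (by fun_prop) _ _), intervalIntegral.integral_sub
    (Continuous.intervalIntegrable (by fun_prop) _ _)
    (Continuous.intervalIntegrable (by fun_prop) _ _), intervalIntegral.integral_smul,
    intervalIntegral.integral_smul, h1, h2, integral_pow_smul_moment hg 0 2 z]
  norm_num
  module

end Moments

/-! ### Integrals quadratic in the field. -/

section QuadraticMoments

variable {E : Type*} [NormedAddCommGroup E] [InnerProductSpace ℝ E] [CompleteSpace E] {g : ℝ → E}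

/-- Integrate the derivative of `s ‖m₀(s)‖²`, where `m₀` is `moment g 0`. The remaining integral is
the one in the definition of `c`. -/
theorem integral_inner_moment_self (hg : Continuous g) (h : ℝ) :
    ∫ s in (0 : ℝ)..h, inner ℝ (moment g 0 s) (moment g 0 s)
      = h * ‖moment g 0 h‖ ^ 2 - 2 * ∫ s in (0 : ℝ)..h, s * inner ℝ (g s) (moment g 0 s) := by
  have hc := continuous_moment hg 0
  have hd : ∀ s, HasDerivAt (fun s => s * inner ℝ (moment g 0 s) (moment g 0 s))
      (inner ℝ (moment g 0 s) (moment g 0 s) + 2 * (s * inner ℝ (g s) (moment g 0 s))) s := by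
    intro s
    have hm := hasDerivAt_moment hg 0 s
    refine ((hasDerivAt_id s).mul (hm.inner ℝ hm)).congr_deriv ?_
    simp [real_inner_comm (g s)]
    ring
  have := intervalIntegral.integral_eq_sub_of_hasDerivAt (a := 0) (b := h) (fun s _ => hd s)
    (Continuous.intervalIntegrable (by fun_prop) _ _)
  rw [intervalIntegral.integral_add (Continuous.intervalIntegrable (by fun_prop) _ _)
    (Continuous.intervalIntegrable (by fun_prop) _ _), intervalIntegral.integral_const_mul,
    real_inner_self_eq_norm_sq] at this
  linarith

/-- Integrate the derivative of `⟨m₀(s), m₁(s)⟩`; this reduces to the same quadratic integral. -/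
theorem integral_inner_moment_one (hg : Continuous g) (h : ℝ) :
    ∫ s in (0 : ℝ)..h, inner ℝ (moment g 1 s) (g s)
      = inner ℝ (moment g 0 h) (moment g 1 h)
        - ∫ s in (0 : ℝ)..h, s * inner ℝ (g s) (moment g 0 s) := by
  have hc := continuous_moment hg 0
  have hc1 := continuous_moment hg 1
  have hd : ∀ s, HasDerivAt (fun s => inner ℝ (moment g 0 s) (moment g 1 s))
      (inner ℝ (moment g 1 s) (g s) + s * inner ℝ (g s) (moment g 0 s)) s := by
    intro s
    refine ((hasDerivAt_moment hg 0 s).inner ℝ (hasDerivAt_moment hg 1 s)).congr_deriv ?_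
    simp [real_inner_comm (g s), inner_smul_right]
    ring
  have := intervalIntegral.integral_eq_sub_of_hasDerivAt (a := 0) (b := h) (fun s _ => hd s)
    (Continuous.intervalIntegrable (by fun_prop) _ _)
  rw [intervalIntegral.integral_add (Continuous.intervalIntegrable (by fun_prop) _ _)
    (Continuous.intervalIntegrable (by fun_prop) _ _)] at this
  simp at this
  linarith

end QuadraticMoments

/-! ### Bernoulli moments in terms of plain moments. -/

section Bernoulli

variable {n : ℕ}

theorem rescaledBernoulli_zero (h ζ : ℝ) : rescaledBernoulli 0 h ζ = 1 := by
  simp [rescaledBernoulli]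

theorem rescaledBernoulli_one {h : ℝ} (hh : h ≠ 0) (ζ : ℝ) :
    rescaledBernoulli 1 h ζ = ζ - h / 2 := by
  simp [rescaledBernoulli, Polynomial.bernoulli_def, Finset.sum_range_succ, bernoulli_one]
  field_simp
  ring

theorem rescaledBernoulli_two {h : ℝ} (hh : h ≠ 0) (ζ : ℝ) :
    rescaledBernoulli 2 h ζ = ζ ^ 2 - h * ζ + h ^ 2 / 6 := by
  simp [rescaledBernoulli, Polynomial.bernoulli_def, Finset.sum_range_succ, bernoulli_one,
    bernoulli_two, Polynomial.aeval_monomial]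
  field_simp
  ring

theorem rescaledBernoulli_three {h : ℝ} (hh : h ≠ 0) (ζ : ℝ) :
    rescaledBernoulli 3 h ζ = ζ ^ 3 - 3 / 2 * h * ζ ^ 2 + h ^ 2 / 2 * ζ := by
  have hb : bernoulli 3 = 0 := bernoulli_eq_zero_of_odd (by decide) (by norm_num)
  simp [rescaledBernoulli, hb, Polynomial.bernoulli_def, Finset.sum_range_succ, bernoulli_one,
    bernoulli_two, Polynomial.aeval_monomial]
  field_simp
  ring

variable {e : ℝ → Space n} {t h : ℝ}

theorem mu_zero_eq : mu e 0 t h = moment (fun ζ => e (t + ζ)) 0 h := by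
  simp [mu, moment, rescaledBernoulli_zero]

theorem mu_one_eq (he : Continuous e) (hh : h ≠ 0) : mu e 1 t h =
    moment (fun ζ => e (t + ζ)) 1 h - (h / 2) • moment (fun ζ => e (t + ζ)) 0 h := by
  simp only [mu, moment, rescaledBernoulli_one hh]
  rw [← intervalIntegral.integral_smul, ← intervalIntegral.integral_sub
    (Continuous.intervalIntegrable (by fun_prop) _ _)
    (Continuous.intervalIntegrable (by fun_prop) _ _)]
  congr 1
  funext ζ
  module

theorem mu_two_eq (he : Continuous e) (hh : h ≠ 0) : mu e 2 t h =
    moment (fun ζ => e (t + ζ)) 2 h - h • moment (fun ζ => e (t + ζ)) 1 h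
      + (h ^ 2 / 6) • moment (fun ζ => e (t + ζ)) 0 h := by
  simp only [mu, moment, rescaledBernoulli_two hh]
  rw [← intervalIntegral.integral_smul, ← intervalIntegral.integral_smul,
    ← intervalIntegral.integral_sub
    (Continuous.intervalIntegrable (by fun_prop) _ _)
    (Continuous.intervalIntegrable (by fun_prop) _ _), ← intervalIntegral.integral_add
    (Continuous.intervalIntegrable (by fun_prop) _ _)
    (Continuous.intervalIntegrable (by fun_prop) _ _)]
  congr 1
  funext ζ
  module

theorem mu_three_eq (he : Continuous e) (hh : h ≠ 0) : mu e 3 t h =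
    moment (fun ζ => e (t + ζ)) 3 h - (3 / 2 * h) • moment (fun ζ => e (t + ζ)) 2 h
      + (h ^ 2 / 2) • moment (fun ζ => e (t + ζ)) 1 h := by
  simp only [mu, moment, rescaledBernoulli_three hh]
  rw [← intervalIntegral.integral_smul, ← intervalIntegral.integral_smul,
    ← intervalIntegral.integral_sub
    (Continuous.intervalIntegrable (by fun_prop) _ _)
    (Continuous.intervalIntegrable (by fun_prop) _ _), ← intervalIntegral.integral_add
    (Continuous.intervalIntegrable (by fun_prop) _ _)
    (Continuous.intervalIntegrable (by fun_prop) _ _)]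
  congr 1
  funext ζ
  module

end Bernoulli

/-! ### Evaluation of the Magnus terms. -/

section MagnusTerms

variable {n : ℕ}

theorem intervalIntegral_inner_const {φ : ℝ → Space n} (hφ : Continuous φ) (w : Space n)
    (a b : ℝ) : ∫ s in a..b, inner ℝ (φ s) w = inner ℝ (∫ s in a..b, φ s) w := by
  simp only [fun s => real_inner_comm w (φ s), real_inner_comm w (∫ s in a..b, φ s)]
  exact (innerSL ℝ w).intervalIntegral_comp_comm (hφ.intervalIntegrable _ _)

theorem intervalIntegral_const_inner {φ : ℝ → Space n} (hφ : Continuous φ) (w : Space n)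
    (a b : ℝ) : ∫ s in a..b, inner ℝ w (φ s) = inner ℝ w (∫ s in a..b, φ s) :=
  (innerSL ℝ w).intervalIntegral_comp_comm (hφ.intervalIntegrable _ _)

/-- Here `w` plays the role of `∇V₀(x)`. The part linear in `w` contributes to `q`, the part free of
`w` to `c`; the same holds in `integral_inner_theta32`. -/
theorem integral_inner_theta31 {g : ℝ → Space n} (hg : Continuous g) (w : Space n) (h : ℝ) :
    ∫ ζ in (0 : ℝ)..h, ∫ ξ in (0 : ℝ)..ζ, ∫ χ in (0 : ℝ)..ζ,
      inner ℝ ((2 : ℝ) • (g ζ - g χ)) (w + g ξ) =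
    inner ℝ ((3 : ℝ) • moment g 2 h - h ^ 2 • moment g 0 h) w
      + (6 * (∫ s in (0 : ℝ)..h, s * inner ℝ (g s) (moment g 0 s)) - 2 * h * ‖moment g 0 h‖ ^ 2) := by
  have hc := continuous_moment hg 0
  have h1 : ∀ ζ ξ : ℝ, ∫ χ in (0 : ℝ)..ζ, inner ℝ ((2 : ℝ) • (g ζ - g χ)) (w + g ξ)
      = inner ℝ ((2 : ℝ) • (ζ • g ζ - moment g 0 ζ)) (w + g ξ) := by
    intro ζ ξ
    rw [intervalIntegral_inner_const (by fun_prop), integral_sub_const_left hg]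
  have h2 : ∀ ζ : ℝ, ∫ ξ in (0 : ℝ)..ζ, inner ℝ ((2 : ℝ) • (ζ • g ζ - moment g 0 ζ)) (w + g ξ)
      = inner ℝ (ζ • (2 : ℝ) • (ζ • g ζ - moment g 0 ζ)) w
        + (2 * (ζ * inner ℝ (g ζ) (moment g 0 ζ)) - 2 * inner ℝ (moment g 0 ζ) (moment g 0 ζ)) := by
    intro ζ
    rw [intervalIntegral_const_inner (by fun_prop), intervalIntegral.integral_add (by simp)
      (hg.intervalIntegrable _ _)]
    have : ∫ ξ in (0 : ℝ)..ζ, g ξ = moment g 0 ζ := by simp [moment]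
    rw [this]
    simp only [intervalIntegral.integral_const, sub_zero, inner_add_right, inner_smul_left,
      inner_smul_right, inner_sub_left]
    simp
    ring
  simp only [h1, h2]
  rw [intervalIntegral.integral_add (Continuous.intervalIntegrable (by fun_prop) _ _)
    (Continuous.intervalIntegrable (by fun_prop) _ _), intervalIntegral_inner_const (by fun_prop),
    integral_double_mul_sub hg, intervalIntegral.integral_sub
    (Continuous.intervalIntegrable (by fun_prop) _ _)
    (Continuous.intervalIntegrable (by fun_prop) _ _), intervalIntegral.integral_const_mul,
    intervalIntegral.integral_const_mul, integral_inner_moment_self hg]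
  ring

theorem integral_inner_theta32 {g : ℝ → Space n} (hg : Continuous g) (w : Space n) (h : ℝ) :
    ∫ ζ in (0 : ℝ)..h, ∫ ξ in (0 : ℝ)..ζ, ∫ χ in (0 : ℝ)..ξ,
      inner ℝ ((2 : ℝ) • (g ξ - g χ)) (w + g ζ) =
    inner ℝ ((4 * h) • moment g 1 h - (3 : ℝ) • moment g 2 h - h ^ 2 • moment g 0 h) w
      + (4 * inner ℝ (moment g 0 h) (moment g 1 h)
        - 6 * (∫ s in (0 : ℝ)..h, s * inner ℝ (g s) (moment g 0 s))) := by
  have hc := continuous_moment hg 0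
  have hc1 := continuous_moment hg 1
  have h1 : ∀ ζ ξ : ℝ, ∫ χ in (0 : ℝ)..ξ, inner ℝ ((2 : ℝ) • (g ξ - g χ)) (w + g ζ)
      = inner ℝ ((2 : ℝ) • (ξ • g ξ - moment g 0 ξ)) (w + g ζ) := by
    intro ζ ξ
    rw [intervalIntegral_inner_const (by fun_prop), integral_sub_const_left hg]
  have h2 : ∀ ζ : ℝ, ∫ ξ in (0 : ℝ)..ζ, inner ℝ ((2 : ℝ) • (ξ • g ξ - moment g 0 ξ)) (w + g ζ)
      = inner ℝ ((4 : ℝ) • moment g 1 ζ - (2 * ζ) • moment g 0 ζ) w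
        + (4 * inner ℝ (moment g 1 ζ) (g ζ) - 2 * (ζ * inner ℝ (g ζ) (moment g 0 ζ))) := by
    intro ζ
    rw [intervalIntegral_inner_const (by fun_prop), integral_double_sub hg]
    rw [inner_add_right, inner_sub_left _ _ (g ζ), inner_smul_left, inner_smul_left,
      real_inner_comm (g ζ) (moment g 0 ζ)]
    simp
    ring
  simp only [h1, h2]
  rw [intervalIntegral.integral_add (Continuous.intervalIntegrable (by fun_prop) _ _)
    (Continuous.intervalIntegrable (by fun_prop) _ _), intervalIntegral_inner_const (by fun_prop),
    integral_triple_sub hg, intervalIntegral.integral_sub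
    (Continuous.intervalIntegrable (by fun_prop) _ _)
    (Continuous.intervalIntegrable (by fun_prop) _ _), intervalIntegral.integral_const_mul,
    intervalIntegral.integral_const_mul, integral_inner_moment_one hg]
  ring

variable {ε : ℝ} {V₀ : Space n → ℝ} {e : ℝ → Space n} {t h : ℝ}

theorem op_lie_skew (A B : Op n) : ⁅A, B⁆ = -⁅B, A⁆ := by
  simp [Ring.lie_def]

theorem op_lie_neg (A B : Op n) : ⁅A, -B⁆ = -⁅A, B⁆ := by
  simp [Ring.lie_def]
  abel

/-- The scalar part of the inner bracket commutes with everything, and `(iε⁻¹)(iε) = -1`. Because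
neither `σ` nor `τ` survives, the fourth-order Magnus terms are linear in `e`. -/
theorem schrOp_lie_lie_dirDeriv (hε : ε ≠ 0) (hV₀ : V₀.HasTemperateGrowth) (σ τ : ℝ)
    (d : Space n) :
    ⁅schrOp ε V₀ e σ, ⁅schrOp ε V₀ e τ, dirDeriv d⁆⁆ = -⁅(lap : Op n), gradOp V₀ d⁆ := by
  have h : ∀ (A B : Op n) (c k : ℂ), ⁅A, c • (B + k • 1)⁆ = c • ⁅A, B⁆ := by
    intro A B c k
    simp only [Ring.lie_def, mul_smul_comm, smul_mul_assoc, mul_add, add_mul, mul_one, one_mul]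
    module
  have hε' : (ε : ℂ) ≠ 0 := by exact_mod_cast hε
  rw [schrOp_lie_dirDeriv e hV₀, h, schrOp_lie_gradOp e hV₀, smul_smul]
  have : Complex.I * (ε : ℂ)⁻¹ * (Complex.I * ε) = -1 := by
    field_simp
    simp
  rw [this]
  simp

theorem schrOp_lie_dirDeriv_apply (hV₀ : V₀.HasTemperateGrowth) (τ : ℝ) (d : Space n)
    (u : 𝓢(Space n, ℂ)) (x : Space n) : ⁅schrOp ε V₀ e τ, dirDeriv d⁆ u x
      = Complex.I * (ε : ℂ)⁻¹ * u x * (inner ℝ d (∇ V₀ x + e τ) : ℝ) := by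
  rw [schrOp_lie_dirDeriv e hV₀]
  simp [gradOp_apply hV₀, inner_add_right]
  ring

/-- `d ↦ [Δ, dᵀ∇V]`, applied to `u` and evaluated at `x`, is linear. -/
theorem exists_clm_lap_lie_gradOp (hV₀ : V₀.HasTemperateGrowth) (u : 𝓢(Space n, ℂ))
    (x : Space n) : ∃ L : Space n →L[ℝ] ℂ, ∀ d, ⁅(lap : Op n), gradOp V₀ d⁆ u x = L d := by
  -- Continuity is automatic, since `Space n` is finite-dimensional; it allows `L` to be exchanged
  -- with the integrals.
  refine ⟨LinearMap.toContinuousLinearMap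
    { toFun := fun d => ⁅(lap : Op n), gradOp V₀ d⁆ u x
      map_add' := fun a b => ?_
      map_smul' := fun c a => ?_ }, fun d => rfl⟩
  · have : ⁅(lap : Op n), gradOp V₀ (a + b)⁆
        = ⁅(lap : Op n), gradOp V₀ a⁆ + ⁅(lap : Op n), gradOp V₀ b⁆ := by
      rw [gradOp_add hV₀]
      simp only [Ring.lie_def, mul_add, add_mul]
      abel
    rw [this]
    rfl
  · have : ⁅(lap : Op n), gradOp V₀ (c • a)⁆ = (c : ℂ) • ⁅(lap : Op n), gradOp V₀ a⁆ := by
      rw [gradOp_smul hV₀]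
      simp only [Ring.lie_def, mul_smul_comm, smul_mul_assoc]
      module
    rw [this]
    simp

theorem theta1_eq (hV₀ : V₀.HasTemperateGrowth) (he : Continuous e) (u : 𝓢(Space n, ℂ))
    (x : Space n) : theta1 (schrOp ε V₀ e) t h u x =
      Complex.I * ε * h * lap u x - Complex.I * (ε : ℂ)⁻¹ * u x *
        (h * V₀ x + inner ℝ (moment (fun ζ => e (t + ζ)) 0 h) x : ℝ) := by
  have h1 : ∀ τ, schrOp ε V₀ e τ u x = Complex.I * ε * lap u x
      - Complex.I * (ε : ℂ)⁻¹ * u x * (V₀ x + inner ℝ (e τ) x : ℝ) := by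
    intro τ
    rw [schrOp_eq e hV₀]
    simp [mulOp_apply (hasTemperateGrowth_ofReal hV₀), linOp_apply]
    ring
  have h2 : ∫ ζ in (0 : ℝ)..h, e (t + ζ) = moment (fun ζ => e (t + ζ)) 0 h := by simp [moment]
  simp only [theta1, h1]
  rw [intervalIntegral.integral_sub (by simp) (Continuous.intervalIntegrable (by fun_prop) _ _),
    intervalIntegral.integral_const_mul (Complex.I * (ε : ℂ)⁻¹ * u x),
    intervalIntegral.integral_ofReal, intervalIntegral.integral_add (by simp) (Continuous.intervalIntegrable (by fun_prop) _ _),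
    intervalIntegral_inner_const (by fun_prop), h2]
  simp
  ring

theorem theta2_eq (hε : ε ≠ 0) (hV₀ : V₀.HasTemperateGrowth) (he : Continuous e)
    (u : 𝓢(Space n, ℂ)) (x : Space n) : theta2 (schrOp ε V₀ e) t h u x =
      -fderiv ℝ u x ((2 : ℝ) • moment (fun ζ => e (t + ζ)) 1 h
        - h • moment (fun ζ => e (t + ζ)) 0 h) := by
  have hg : Continuous fun ζ => e (t + ζ) := by fun_prop
  have hc := continuous_moment hg 0
  simp only [theta2, schrOp_lie_schrOp e hε hV₀, dirDeriv_apply]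
  have h1 : ∀ ζ : ℝ, ∫ ξ in (0 : ℝ)..ζ, fderiv ℝ u x ((2 : ℝ) • (e (t + ζ) - e (t + ξ)))
      = fderiv ℝ u x ((2 : ℝ) • (ζ • e (t + ζ) - moment (fun ζ => e (t + ζ)) 0 ζ)) := by
    intro ζ
    rw [(fderiv ℝ u x).intervalIntegral_comp_comm (Continuous.intervalIntegrable (by fun_prop) _ _),
      integral_sub_const_left hg]
  simp only [h1]
  rw [(fderiv ℝ u x).intervalIntegral_comp_comm (Continuous.intervalIntegrable (by fun_prop) _ _),
    integral_double_sub hg]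
  simp
  ring

theorem theta31_eq (hε : ε ≠ 0) (hV₀ : V₀.HasTemperateGrowth) (he : Continuous e)
    (u : 𝓢(Space n, ℂ)) (x : Space n) : theta31 (schrOp ε V₀ e) t h u x =
      (1 / 12) * (Complex.I * (ε : ℂ)⁻¹ * u x *
        (inner ℝ ((3 : ℝ) • moment (fun ζ => e (t + ζ)) 2 h
          - h ^ 2 • moment (fun ζ => e (t + ζ)) 0 h) (∇ V₀ x)
        + (6 * (∫ s in (0 : ℝ)..h, s * inner ℝ (e (t + s)) (moment (fun ζ => e (t + ζ)) 0 s))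
          - 2 * h * ‖moment (fun ζ => e (t + ζ)) 0 h‖ ^ 2) : ℝ)) := by
  have hg : Continuous fun ζ => e (t + ζ) := by fun_prop
  simp only [theta31, schrOp_lie_schrOp e hε hV₀, schrOp_lie_dirDeriv_apply hV₀,
    intervalIntegral.integral_const_mul, intervalIntegral.integral_ofReal,
    integral_inner_theta31 hg (∇ V₀ x) h]

theorem theta32_eq (hε : ε ≠ 0) (hV₀ : V₀.HasTemperateGrowth) (he : Continuous e)
    (u : 𝓢(Space n, ℂ)) (x : Space n) : theta32 (schrOp ε V₀ e) t h u x =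
      -(1 / 4) * (Complex.I * (ε : ℂ)⁻¹ * u x *
        (inner ℝ ((4 * h) • moment (fun ζ => e (t + ζ)) 1 h
          - (3 : ℝ) • moment (fun ζ => e (t + ζ)) 2 h
          - h ^ 2 • moment (fun ζ => e (t + ζ)) 0 h) (∇ V₀ x)
        + (4 * inner ℝ (moment (fun ζ => e (t + ζ)) 0 h) (moment (fun ζ => e (t + ζ)) 1 h)
        - 6 * (∫ s in (0 : ℝ)..h, s * inner ℝ (e (t + s)) (moment (fun ζ => e (t + ζ)) 0 s))) : ℝ)) := by
  have hg : Continuous fun ζ => e (t + ζ) := by fun_prop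
  have h1 : ∀ (τ : ℝ) (d : Space n), ⁅dirDeriv d, schrOp ε V₀ e τ⁆ u x
      = -(Complex.I * (ε : ℂ)⁻¹ * u x) * (inner ℝ d (∇ V₀ x + e τ) : ℝ) := by
    intro τ d
    rw [op_lie_skew]
    change -(⁅schrOp ε V₀ e τ, dirDeriv d⁆ u x) = _
    rw [schrOp_lie_dirDeriv_apply hV₀]
    ring
  simp only [theta32, schrOp_lie_schrOp e hε hV₀, h1,
    intervalIntegral.integral_const_mul, intervalIntegral.integral_ofReal,
    integral_inner_theta32 hg (∇ V₀ x) h]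
  ring

/-- Every nested commutator here is `±L d` with `d` a difference of two values of `e`, so the three
integrals can be computed under `L`. In their sum the zeroth moments cancel, and the others combine
to `μ₃ / 3`. -/
theorem theta4_eq (hε : ε ≠ 0) (hV₀ : V₀.HasTemperateGrowth) (he : Continuous e) (hh : h ≠ 0)
    (u : 𝓢(Space n, ℂ)) (x : Space n) :
    theta41 (schrOp ε V₀ e) t h u x + theta42 (schrOp ε V₀ e) t h u x
      + theta43 (schrOp ε V₀ e) t h u x = C1 V₀ e t h u x := by
  set g := fun ζ => e (t + ζ) with hg_def
  have hg : Continuous g := by fun_prop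
  have hc := continuous_moment hg 0
  have hc1 := continuous_moment hg 1
  have hc2 := continuous_moment hg 2
  obtain ⟨L, hL⟩ := exists_clm_lap_lie_gradOp hV₀ u x
  have hC : C1 V₀ e t h u x = L (pVec e t h) := hL _
  have h1 : ∀ (σ τ : ℝ) (d : Space n),
      ⁅schrOp ε V₀ e σ, ⁅dirDeriv d, schrOp ε V₀ e τ⁆⁆ u x = L d := by
    intro σ τ d
    rw [op_lie_skew (dirDeriv d), op_lie_neg, schrOp_lie_lie_dirDeriv hε hV₀, neg_neg, hL]
  have h2 : ∀ (σ τ : ℝ) (d : Space n),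
      ⁅⁅schrOp ε V₀ e σ, dirDeriv d⁆, schrOp ε V₀ e τ⁆ u x = L d := by
    intro σ τ d
    rw [op_lie_skew, schrOp_lie_lie_dirDeriv hε hV₀, neg_neg, hL]
  have h3 : ∀ (σ τ : ℝ) (d : Space n),
      ⁅⁅dirDeriv d, schrOp ε V₀ e σ⁆, schrOp ε V₀ e τ⁆ u x = -L d := by
    intro σ τ d
    rw [op_lie_skew, op_lie_skew (dirDeriv d), op_lie_neg, schrOp_lie_lie_dirDeriv hε hV₀, neg_neg,
      ← hL]
    rfl
  have hLi : ∀ {φ : ℝ → Space n} (_ : Continuous φ) (b : ℝ),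
      ∫ s in (0 : ℝ)..b, L (φ s) = L (∫ s in (0 : ℝ)..b, φ s) := fun hφ b =>
    L.intervalIntegral_comp_comm (hφ.intervalIntegrable _ _)
  have i1 : ∀ z : ℝ, ∫ s in (0 : ℝ)..z, L ((2 : ℝ) • (g z - g s))
      = L ((2 : ℝ) • (z • g z - moment g 0 z)) := fun z => by
    rw [hLi (by fun_prop), integral_sub_const_left hg]
  have i2 : ∀ z : ℝ, ∫ s in (0 : ℝ)..z, L ((2 : ℝ) • (s • g s - moment g 0 s))
      = L ((4 : ℝ) • moment g 1 z - (2 * z) • moment g 0 z) := fun z => by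
    rw [hLi (by fun_prop), integral_double_sub hg]
  have i3 : ∀ z : ℝ, ∫ s in (0 : ℝ)..z, L (s • (2 : ℝ) • (s • g s - moment g 0 s))
      = L ((3 : ℝ) • moment g 2 z - z ^ 2 • moment g 0 z) := fun z => by
    rw [hLi (by fun_prop), integral_double_mul_sub hg]
  have i4 : ∀ z : ℝ, ∫ s in (0 : ℝ)..z, L ((4 : ℝ) • moment g 1 s - (2 * s) • moment g 0 s)
      = L ((4 * z) • moment g 1 z - (3 : ℝ) • moment g 2 z - z ^ 2 • moment g 0 z) := fun z => by
    rw [hLi (by fun_prop), integral_triple_sub hg]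
  have hconst : ∀ (z : ℝ) (d : Space n), ∫ _ in (0 : ℝ)..z, L d = L (z • d) := fun z d => by
    simp
  have e1 : theta41 (schrOp ε V₀ e) t h u x = -(1 / 24) * L ((2 * h ^ 2) • moment g 1 h
      - (4 / 3 : ℝ) • moment g 3 h - (2 / 3 * h ^ 3) • moment g 0 h) := by
    simp only [theta41, schrOp_lie_schrOp e hε hV₀, h1]
    change _ * (∫ ζ in (0 : ℝ)..h, ∫ ξ in (0 : ℝ)..ζ, ∫ χ in (0 : ℝ)..ζ, ∫ ν in (0 : ℝ)..χ,
      L ((2 : ℝ) • (g χ - g ν))) = _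
    simp only [i1, i2, hconst]
    rw [hLi (by fun_prop), integral_triple_mul_sub hg]
  have e2 : theta42 (schrOp ε V₀ e) t h u x = -(1 / 24) * L ((3 * h) • moment g 2 h
      - (8 / 3 : ℝ) • moment g 3 h - (h ^ 3 / 3) • moment g 0 h) := by
    simp only [theta42, schrOp_lie_schrOp e hε hV₀, h2]
    change _ * (∫ ζ in (0 : ℝ)..h, ∫ ξ in (0 : ℝ)..ζ, ∫ χ in (0 : ℝ)..ξ, ∫ ν in (0 : ℝ)..ξ,
      L ((2 : ℝ) • (g ξ - g ν))) = _
    simp only [i1, hconst, i3]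
    rw [hLi (by fun_prop), integral_three_sub hg]
  -- The sign of `-1/8` flips because both outer brackets are of the form `[·, 𝒜]`, and three
  -- reversals in all (two here, one in the identity for the double bracket) leave `-L`.
  have e3 : theta43 (schrOp ε V₀ e) t h u x = (1 / 8) * L ((2 * h ^ 2) • moment g 1 h
      - (3 * h) • moment g 2 h + (4 / 3 : ℝ) • moment g 3 h - (h ^ 3 / 3) • moment g 0 h) := by
    simp only [theta43, schrOp_lie_schrOp e hε hV₀, h3, intervalIntegral.integral_neg]
    change _ * -(∫ ζ in (0 : ℝ)..h, ∫ ξ in (0 : ℝ)..ζ, ∫ χ in (0 : ℝ)..ξ, ∫ ν in (0 : ℝ)..χ,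
      L ((2 : ℝ) • (g χ - g ν))) = _
    simp only [i1, i2, i4]
    rw [hLi (by fun_prop), integral_four_sub hg]
    ring
  rw [e1, e2, e3, hC, pVec, mu_three_eq he hh]
  simp only [map_add, map_sub, map_smul, Complex.real_smul]
  push_cast
  ring

theorem W1_apply (hV₀ : V₀.HasTemperateGrowth) (u : 𝓢(Space n, ℂ)) (x : Space n) :
    W1 ε V₀ e t h u x = (-(Complex.I * (h : ℂ) * (ε : ℂ)⁻¹)
      * ((V₀ x + inner ℝ (rVec e t h) x : ℝ) : ℂ)
      + Complex.I * (ε : ℂ)⁻¹ * ((inner ℝ (qVec e t h) (∇ V₀ x) : ℝ) : ℂ)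
      + cScalar ε e t h) * u x :=
  mulOp_apply (.add (.add (.mul (.const _) (hasTemperateGrowth_ofReal
    (f := fun x => V₀ x + inner ℝ (rVec e t h) x) (hV₀.add (by fun_prop)))) (.mul (.const _)
    (hasTemperateGrowth_ofReal (hasTemperateGrowth_inner_gradient hV₀ _)))) (.const _)) u x

theorem Theta4_eq (hε : ε ≠ 0) (hV₀ : V₀.HasTemperateGrowth) (he : Continuous e) (hh : h ≠ 0)
    (u : 𝓢(Space n, ℂ)) (x : Space n) :
    Theta4 (schrOp ε V₀ e) t h u x = ((T1 ε e t h + W1 ε V₀ e t h + C1 V₀ e t h) u) x := by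
  have h4 := theta4_eq (t := t) hε hV₀ he hh u x
  have hT : T1 ε e t h u x = Complex.I * h * ε * lap u x - fderiv ℝ u x (sVec e t h) := rfl
  have hs : ((T1 ε e t h + W1 ε V₀ e t h + C1 V₀ e t h) u) x
      = T1 ε e t h u x + W1 ε V₀ e t h u x + C1 V₀ e t h u x := rfl
  have hm0 : ∀ z : ℝ, ∫ ζ in (0 : ℝ)..z, e (t + ζ) = moment (fun ζ => e (t + ζ)) 0 z := by
    simp [moment]
  have hm1 : ∫ ζ in (0 : ℝ)..h, ζ • e (t + ζ) = moment (fun ζ => e (t + ζ)) 1 h := by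
    simp [moment]
  rw [hs, hT, W1_apply hV₀, ← h4, Theta4, theta1_eq hV₀ he, theta2_eq hε hV₀ he, theta31_eq hε hV₀ he,
    theta32_eq hε hV₀ he, cScalar, rVec, qVec, sVec, mu_zero_eq, mu_one_eq he hh, mu_two_eq he hh]
  simp only [hm0, hm1, inner_add_left, inner_sub_left, inner_smul_left, map_sub, map_smul,
    Complex.real_smul]
  simp
  have hh' : (h : ℂ) ≠ 0 := by exact_mod_cast hh
  have hε' : (ε : ℂ) ≠ 0 := by exact_mod_cast hε
  field_simp
  ring

end MagnusTerms

/-! ### Dependence on the field at nonnegative times only. -/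

section Congruence

variable {n : ℕ}

theorem intervalIntegral_congr_nonneg {E : Type*} [NormedAddCommGroup E] [NormedSpace ℝ E]
    {f g : ℝ → E} {b : ℝ} (hb : 0 ≤ b) (h : ∀ s, 0 ≤ s → f s = g s) :
    ∫ s in (0 : ℝ)..b, f s = ∫ s in (0 : ℝ)..b, g s :=
  intervalIntegral.integral_congr fun s hs => h s (by rw [Set.uIcc_of_le hb] at hs; exact hs.1)

section Terms

variable {A A' : ℝ → Op n} {t h : ℝ}

theorem theta1_congr (hA : ∀ s, 0 ≤ s → A (t + s) = A' (t + s)) (hh : 0 ≤ h)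
    (u : 𝓢(Space n, ℂ)) (x : Space n) : theta1 A t h u x = theta1 A' t h u x := by
  refine intervalIntegral_congr_nonneg hh fun ζ hζ => ?_
  rw [hA ζ hζ]

theorem theta2_congr (hA : ∀ s, 0 ≤ s → A (t + s) = A' (t + s)) (hh : 0 ≤ h)
    (u : 𝓢(Space n, ℂ)) (x : Space n) : theta2 A t h u x = theta2 A' t h u x := by
  unfold theta2
  congr 1
  refine intervalIntegral_congr_nonneg hh fun ζ hζ => ?_
  refine intervalIntegral_congr_nonneg hζ fun ξ hξ => ?_
  rw [hA ζ hζ, hA ξ hξ]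

theorem theta31_congr (hA : ∀ s, 0 ≤ s → A (t + s) = A' (t + s)) (hh : 0 ≤ h)
    (u : 𝓢(Space n, ℂ)) (x : Space n) : theta31 A t h u x = theta31 A' t h u x := by
  unfold theta31
  congr 1
  refine intervalIntegral_congr_nonneg hh fun ζ hζ => ?_
  refine intervalIntegral_congr_nonneg hζ fun ξ hξ => ?_
  refine intervalIntegral_congr_nonneg hζ fun χ hχ => ?_
  rw [hA ζ hζ, hA ξ hξ, hA χ hχ]

theorem theta32_congr (hA : ∀ s, 0 ≤ s → A (t + s) = A' (t + s)) (hh : 0 ≤ h)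
    (u : 𝓢(Space n, ℂ)) (x : Space n) : theta32 A t h u x = theta32 A' t h u x := by
  unfold theta32
  congr 1
  refine intervalIntegral_congr_nonneg hh fun ζ hζ => ?_
  refine intervalIntegral_congr_nonneg hζ fun ξ hξ => ?_
  refine intervalIntegral_congr_nonneg hξ fun χ hχ => ?_
  rw [hA ζ hζ, hA ξ hξ, hA χ hχ]

theorem theta41_congr (hA : ∀ s, 0 ≤ s → A (t + s) = A' (t + s)) (hh : 0 ≤ h)
    (u : 𝓢(Space n, ℂ)) (x : Space n) : theta41 A t h u x = theta41 A' t h u x := by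
  unfold theta41
  congr 1
  refine intervalIntegral_congr_nonneg hh fun ζ hζ => ?_
  refine intervalIntegral_congr_nonneg hζ fun ξ hξ => ?_
  refine intervalIntegral_congr_nonneg hζ fun χ hχ => ?_
  refine intervalIntegral_congr_nonneg hχ fun ν hν => ?_
  rw [hA ζ hζ, hA ξ hξ, hA χ hχ, hA ν hν]

theorem theta42_congr (hA : ∀ s, 0 ≤ s → A (t + s) = A' (t + s)) (hh : 0 ≤ h)
    (u : 𝓢(Space n, ℂ)) (x : Space n) : theta42 A t h u x = theta42 A' t h u x := by
  unfold theta42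
  congr 1
  refine intervalIntegral_congr_nonneg hh fun ζ hζ => ?_
  refine intervalIntegral_congr_nonneg hζ fun ξ hξ => ?_
  refine intervalIntegral_congr_nonneg hξ fun χ hχ => ?_
  refine intervalIntegral_congr_nonneg hξ fun ν hν => ?_
  rw [hA ζ hζ, hA ξ hξ, hA χ hχ, hA ν hν]

theorem theta43_congr (hA : ∀ s, 0 ≤ s → A (t + s) = A' (t + s)) (hh : 0 ≤ h)
    (u : 𝓢(Space n, ℂ)) (x : Space n) : theta43 A t h u x = theta43 A' t h u x := by
  unfold theta43
  congr 1
  refine intervalIntegral_congr_nonneg hh fun ζ hζ => ?_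
  refine intervalIntegral_congr_nonneg hζ fun ξ hξ => ?_
  refine intervalIntegral_congr_nonneg hξ fun χ hχ => ?_
  refine intervalIntegral_congr_nonneg hχ fun ν hν => ?_
  rw [hA ζ hζ, hA ξ hξ, hA χ hχ, hA ν hν]

/-- All integration variables are nonnegative. This permits replacing a field that is regular only
on `[0, ∞)` by a continuous extension to `ℝ`. -/
theorem Theta4_congr (hA : ∀ τ, 0 ≤ τ → A τ = A' τ) (ht : 0 ≤ t) (hh : 0 ≤ h)
    (u : 𝓢(Space n, ℂ)) (x : Space n) : Theta4 A t h u x = Theta4 A' t h u x := by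
  have hA' : ∀ s, 0 ≤ s → A (t + s) = A' (t + s) := fun s hs => hA _ (by positivity)
  rw [Theta4, Theta4, theta1_congr hA' hh, theta2_congr hA' hh, theta31_congr hA' hh,
    theta32_congr hA' hh, theta41_congr hA' hh, theta42_congr hA' hh, theta43_congr hA' hh]

end Terms

variable {e e' : ℝ → Space n} {t h : ℝ}

theorem mu_congr (he : ∀ τ, 0 ≤ τ → e τ = e' τ) (ht : 0 ≤ t) (hh : 0 ≤ h) (k : ℕ) :
    mu e k t h = mu e' k t h :=
  intervalIntegral_congr_nonneg hh fun s hs => by rw [he _ (by positivity)]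

theorem cScalar_congr (he : ∀ τ, 0 ≤ τ → e τ = e' τ) (ht : 0 ≤ t) (hh : 0 ≤ h) (ε : ℝ) :
    cScalar ε e t h = cScalar ε e' t h := by
  have he' : ∀ s, 0 ≤ s → e (t + s) = e' (t + s) := fun s hs => he _ (by positivity)
  have h1 : ∀ z, 0 ≤ z → ∫ ζ in (0 : ℝ)..z, e (t + ζ) = ∫ ζ in (0 : ℝ)..z, e' (t + ζ) :=
    fun z hz => intervalIntegral_congr_nonneg hz he'
  have h2 : ∫ ζ in (0 : ℝ)..h, ζ • e (t + ζ) = ∫ ζ in (0 : ℝ)..h, ζ • e' (t + ζ) :=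
    intervalIntegral_congr_nonneg hh fun s hs => by rw [he' s hs]
  have h3 : (∫ ζ in (0 : ℝ)..h, ζ * inner ℝ (e (t + ζ)) (∫ ξ in (0 : ℝ)..ζ, e (t + ξ)))
      = ∫ ζ in (0 : ℝ)..h, ζ * inner ℝ (e' (t + ζ)) (∫ ξ in (0 : ℝ)..ζ, e' (t + ξ)) :=
    intervalIntegral_congr_nonneg hh fun s hs => by rw [he' s hs, h1 s hs]
  rw [cScalar, cScalar, h1 h hh, h2, h3]

theorem T1_congr (he : ∀ τ, 0 ≤ τ → e τ = e' τ) (ht : 0 ≤ t) (hh : 0 ≤ h) (ε : ℝ) :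
    T1 ε e t h = T1 ε e' t h := by
  rw [T1, T1, sVec, sVec, mu_congr he ht hh]

theorem W1_congr (he : ∀ τ, 0 ≤ τ → e τ = e' τ) (ht : 0 ≤ t) (hh : 0 ≤ h) (ε : ℝ)
    (V₀ : Space n → ℝ) : W1 ε V₀ e t h = W1 ε V₀ e' t h := by
  rw [W1, W1, rVec, rVec, qVec, qVec, mu_congr he ht hh, mu_congr he ht hh, cScalar_congr he ht hh]

theorem C1_congr (he : ∀ τ, 0 ≤ τ → e τ = e' τ) (ht : 0 ≤ t) (hh : 0 ≤ h)
    (V₀ : Space n → ℝ) : C1 V₀ e t h = C1 V₀ e' t h := by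
  rw [C1, C1, pVec, pVec, mu_congr he ht hh]

end Congruence

/-! ### Sizes of the coefficients. -/

section Bounds

variable {n : ℕ} {e : ℝ → Space n} {t h T M : ℝ}

/-- The constant `3` is crude: it is the sum of the absolute values of the coefficients of `B₃`, and
it serves for all four degrees. -/
theorem norm_rescaledBernoulli_le {k : ℕ} (hk : k ≤ 3) {ζ : ℝ} (hh : 0 < h) (h0 : 0 ≤ ζ)
    (h1 : ζ ≤ h) : ‖rescaledBernoulli k h ζ‖ ≤ 3 * h ^ k := by
  have h2 : ζ ^ 2 ≤ h ^ 2 := pow_le_pow_left₀ h0 h1 2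
  have h3 : ζ ^ 3 ≤ h ^ 3 := pow_le_pow_left₀ h0 h1 3
  have a2 : h * ζ ≤ h ^ 2 := by nlinarith
  have a3 : h * ζ ^ 2 ≤ h ^ 3 := by nlinarith
  have a3' : h ^ 2 * ζ ≤ h ^ 3 := by nlinarith [sq_nonneg h]
  have p2 : 0 ≤ h * ζ := by positivity
  have p3 : 0 ≤ h * ζ ^ 2 := by positivity
  have p3' : 0 ≤ h ^ 2 * ζ := by positivity
  have q2 : 0 ≤ ζ ^ 2 := by positivity
  have q3 : 0 ≤ ζ ^ 3 := by positivity
  rw [Real.norm_eq_abs, abs_le]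
  interval_cases k
  · rw [rescaledBernoulli_zero]
    norm_num
  · rw [rescaledBernoulli_one hh.ne']
    constructor <;> linarith
  · rw [rescaledBernoulli_two hh.ne']
    constructor <;> linarith
  · rw [rescaledBernoulli_three hh.ne']
    constructor <;> linarith

theorem norm_mu_le {k : ℕ} (hk : k ≤ 3) (hh : 0 < h)
    (hM : ∀ ζ, 0 ≤ ζ → ζ ≤ h → ‖e (t + ζ)‖ ≤ M) : ‖mu e k t h‖ ≤ 3 * M * h ^ (k + 1) := by
  have hM0 : 0 ≤ M := (norm_nonneg _).trans (hM 0 le_rfl hh.le)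
  have := intervalIntegral.norm_integral_le_of_norm_le_const (a := 0) (b := h)
    (f := fun ζ => rescaledBernoulli k h ζ • e (t + ζ)) (C := 3 * h ^ k * M) fun ζ hζ => by
      rw [Set.uIoc_of_le hh.le] at hζ
      rw [norm_smul]
      gcongr
      · exact norm_rescaledBernoulli_le hk hh hζ.1.le hζ.2
      · exact hM ζ hζ.1.le hζ.2
  rw [sub_zero, abs_of_pos hh] at this
  exact this.trans_eq (by ring)

/-- `B₃` has mean zero on `[0, 1]`. -/
theorem mu_three_sub_const (he : Continuous e) (hh : h ≠ 0) (v : Space n) :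
    mu (fun τ => e τ - v) 3 t h = mu e 3 t h := by
  have h0 : mu (fun _ => v) 3 t h = 0 := by
    rw [mu_three_eq continuous_const hh]
    simp only [moment, intervalIntegral.integral_smul_const, integral_pow]
    module
  have hb : Continuous (rescaledBernoulli 3 h) := by
    rw [funext fun ζ => rescaledBernoulli_three hh ζ]
    fun_prop
  have h1 : mu (fun τ => e τ - v) 3 t h = mu e 3 t h - mu (fun _ => v) 3 t h := by
    simp only [mu, smul_sub]
    exact intervalIntegral.integral_sub (Continuous.intervalIntegrable (by fun_prop) _ _)
      (Continuous.intervalIntegrable (by fun_prop) _ _)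
  rw [h1, h0, sub_zero]

/-- Subtracting `e t` does not change `μ₃` but makes the integrand smaller by a factor `h`, which
improves the generic `h⁴` to `h⁵`. -/
theorem norm_mu_three_le (he : Continuous e) (hh : 0 < h) {L : ℝ}
    (hL : ∀ ζ, 0 ≤ ζ → ζ ≤ h → ‖e (t + ζ) - e t‖ ≤ L * ζ) : ‖mu e 3 t h‖ ≤ 3 * L * h ^ 5 := by
  have hL0 : 0 ≤ L := nonneg_of_mul_nonneg_left ((norm_nonneg _).trans (hL h hh.le le_rfl)) hh
  rw [← mu_three_sub_const he hh.ne' (e t)]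
  have h1 := norm_mu_le (e := fun τ => e τ - e t) (t := t) (M := L * h) le_rfl hh
    fun ζ h0 h1 => (hL ζ h0 h1).trans (by gcongr)
  exact h1.trans_eq (by ring)

/-- `X`, `Y`, `Z` stand for the three integrals in `c`. All contributions are of size `M²h³`; this
is weakened to `M²h`, which suffices for `W₁ = O(h)`. -/
theorem norm_quadratic_combination_le (hh : 0 < h) (hh1 : h < 1) {X Y Z : ℝ}
    (h1 : ‖X‖ ≤ h * (M * (M * h)) * h) (h2 : ‖Y‖ ≤ (M * h) * (h * M * h)) (h3 : 0 ≤ h * Z)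
    (h4 : h * Z ≤ h * (M * h) ^ 2) : ‖2 * X - Y - 1 / 6 * h * Z‖ ≤ 4 * (M ^ 2 * h) := by
  have hh3 : M ^ 2 * h ^ 3 ≤ M ^ 2 * h := by
    have : h ^ 3 ≤ h := by nlinarith [mul_pos hh hh]
    gcongr
  rw [Real.norm_eq_abs, abs_le] at h1 h2 ⊢
  have e1 : h * (M * (M * h)) * h = M ^ 2 * h ^ 3 := by ring
  have e2 : (M * h) * (h * M * h) = M ^ 2 * h ^ 3 := by ring
  have e3 : h * (M * h) ^ 2 = M ^ 2 * h ^ 3 := by ring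
  rw [e1] at h1
  rw [e2] at h2
  rw [e3] at h4
  constructor <;> linarith [h1.1, h1.2, h2.1, h2.2]

theorem norm_cScalar_le {ε : ℝ} (hε : 0 < ε) (hh : 0 < h) (h1 : h < 1)
    (hM : ∀ ζ, 0 ≤ ζ → ζ ≤ h → ‖e (t + ζ)‖ ≤ M) : ‖cScalar ε e t h‖ ≤ 4 * ε⁻¹ * M ^ 2 * h := by
  have hM0 : 0 ≤ M := (norm_nonneg _).trans (hM 0 le_rfl hh.le)
  have hI : ∀ z, 0 ≤ z → z ≤ h → ‖∫ ζ in (0 : ℝ)..z, e (t + ζ)‖ ≤ M * h := by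
    intro z hz hzh
    have := intervalIntegral.norm_integral_le_of_norm_le_const (a := 0) (b := z)
      (f := fun ζ => e (t + ζ)) (C := M) fun ζ hζ => by
        rw [Set.uIoc_of_le hz] at hζ
        exact hM ζ hζ.1.le (hζ.2.trans hzh)
    rw [sub_zero, abs_of_nonneg hz] at this
    exact this.trans (by gcongr)
  have hJ : ‖∫ ζ in (0 : ℝ)..h, ζ • e (t + ζ)‖ ≤ h * M * h := by
    have := intervalIntegral.norm_integral_le_of_norm_le_const (a := 0) (b := h)
      (f := fun ζ => ζ • e (t + ζ)) (C := h * M) fun ζ hζ => by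
        rw [Set.uIoc_of_le hh.le] at hζ
        rw [norm_smul, Real.norm_of_nonneg hζ.1.le]
        exact mul_le_mul hζ.2 (hM ζ hζ.1.le hζ.2) (norm_nonneg _) hh.le
    rwa [sub_zero, abs_of_pos hh] at this
  have hX : ‖∫ ζ in (0 : ℝ)..h, ζ * inner ℝ (e (t + ζ)) (∫ ξ in (0 : ℝ)..ζ, e (t + ξ))‖
      ≤ h * (M * (M * h)) * h := by
    have := intervalIntegral.norm_integral_le_of_norm_le_const (a := 0) (b := h)
      (f := fun ζ => ζ * inner ℝ (e (t + ζ)) (∫ ξ in (0 : ℝ)..ζ, e (t + ξ)))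
      (C := h * (M * (M * h))) fun ζ hζ => by
        rw [Set.uIoc_of_le hh.le] at hζ
        rw [norm_mul, Real.norm_of_nonneg hζ.1.le]
        refine mul_le_mul hζ.2 ((norm_inner_le_norm _ _).trans ?_) (norm_nonneg _) hh.le
        exact mul_le_mul (hM ζ hζ.1.le hζ.2) (hI ζ hζ.1.le hζ.2) (norm_nonneg _) hM0
    rwa [sub_zero, abs_of_pos hh] at this
  have hY : ‖inner ℝ (∫ ζ in (0 : ℝ)..h, e (t + ζ)) (∫ ζ in (0 : ℝ)..h, ζ • e (t + ζ))‖
      ≤ (M * h) * (h * M * h) :=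
    (norm_inner_le_norm _ _).trans
      (mul_le_mul (hI h hh.le le_rfl) hJ (norm_nonneg _) (by positivity))
  have hZ : ‖∫ ζ in (0 : ℝ)..h, e (t + ζ)‖ ^ 2 ≤ (M * h) ^ 2 :=
    pow_le_pow_left₀ (norm_nonneg _) (hI h hh.le le_rfl) 2
  have hZ' : h * ‖∫ ζ in (0 : ℝ)..h, e (t + ζ)‖ ^ 2 ≤ h * (M * h) ^ 2 := by gcongr
  have hZ0 : 0 ≤ h * ‖∫ ζ in (0 : ℝ)..h, e (t + ζ)‖ ^ 2 := by positivity
  rw [cScalar, norm_mul, norm_mul, Complex.norm_I, one_mul, norm_inv, Complex.norm_real,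
    Complex.norm_real, Real.norm_of_nonneg hε.le]
  calc _ ≤ ε⁻¹ * (4 * (M ^ 2 * h)) :=
        mul_le_mul_of_nonneg_left (norm_quadratic_combination_le hh h1 hX hY hZ0 hZ') (by positivity)
    _ = _ := by ring

end Bounds

/-! ### Taylor expansion of unitary groups on Schwartz functions. -/

section Taylor

variable {n : ℕ}

/-- The Taylor polynomial of degree less than `m` of `e^A u`. -/
noncomputable def expPoly (A : Op n) (m : ℕ) (u : 𝓢(Space n, ℂ)) : 𝓢(Space n, ℂ) :=
  ∑ k ∈ Finset.range m, ((k.factorial : ℂ)⁻¹) • (A ^ k) u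

theorem hasDerivAt_linearIsometryEquiv_comp {E : Type*} [NormedAddCommGroup E] [NormedSpace ℂ E]
    [NormedSpace ℝ E] [IsScalarTower ℝ ℂ E] (U : E ≃ₗᵢ[ℂ] E) {f : ℝ → E} {f' : E} {τ : ℝ}
    (h : HasDerivAt f f' τ) : HasDerivAt (fun σ => U (f σ)) (U f') τ :=
  (((U : E ≃L[ℂ] E) : E →L[ℂ] E).restrictScalars ℝ).hasFDerivAt.comp_hasDerivAt τ h

/-- The group law `S σ = S τ ∘ S (σ - τ)` transports the derivative at `0` to `τ`. -/
theorem IsUnitaryGroup.hasDerivAt {S : ℝ → (L2 n ≃ₗᵢ[ℂ] L2 n)} (hS : IsUnitaryGroup S)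
    {f g : L2 n} (h : HasDerivAt (fun τ => S τ f) g 0) (τ : ℝ) :
    HasDerivAt (fun σ => S σ f) (S τ g) τ := by
  have h1 : HasDerivAt (fun σ => S (σ - τ) f) g τ := by
    have h' : HasDerivAt (fun τ => S τ f) g (τ - τ) := by rwa [sub_self]
    exact h'.comp_sub_const τ τ
  have h2 := hasDerivAt_linearIsometryEquiv_comp (S τ) h1
  refine h2.congr_of_eventuallyEq (.of_forall fun σ => ?_)
  change S σ f = S τ (S (σ - τ) f)
  rw [← hS.map_add, add_sub_cancel]

/-- The derivative in `τ` of the remainder of degree `m + 1` for `u` is the remainder of degree `m`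
for `A u`, so the mean value inequality drives an induction on `m`. It starts from unitarity; the
factor `τᵐ / m!` is given away. -/
theorem IsUnitaryGroup.norm_sub_taylor_le {S : ℝ → (L2 n ≃ₗᵢ[ℂ] L2 n)} (hS : IsUnitaryGroup S)
    {A : Op n} (hA : ∀ u : 𝓢(Space n, ℂ), HasDerivAt (fun τ => S τ (u.toLp 2 volume)) ((A u).toLp 2 volume) 0)
    (m : ℕ) (u : 𝓢(Space n, ℂ)) {τ : ℝ} (hτ : τ ∈ Set.Icc (0 : ℝ) 1) :
    ‖S τ (u.toLp 2 volume) - ∑ k ∈ Finset.range m, (τ ^ k / k.factorial) • ((A ^ k) u).toLp 2 volume‖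
      ≤ ‖((A ^ m) u).toLp 2 volume‖ := by
  induction m generalizing u τ with
  | zero => simp
  | succ m ih =>
    set R : ℝ → L2 n := fun τ => S τ (u.toLp 2 volume)
      - ∑ k ∈ Finset.range (m + 1), (τ ^ k / k.factorial) • ((A ^ k) u).toLp 2 volume with hR
    have hpow : ∀ k, (A ^ (k + 1)) u = (A ^ k) (A u) := fun k => by rw [pow_succ]; rfl
    have hd : ∀ σ, HasDerivAt R (S σ ((A u).toLp 2 volume)
        - ∑ k ∈ Finset.range m, (σ ^ k / k.factorial) • ((A ^ k) (A u)).toLp 2 volume) σ := by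
      intro σ
      have h1 := hS.hasDerivAt (hA u) σ
      have h2 : HasDerivAt (fun τ : ℝ => ∑ k ∈ Finset.range (m + 1),
          (τ ^ k / k.factorial) • ((A ^ k) u).toLp 2 volume)
          (∑ k ∈ Finset.range m, (σ ^ k / k.factorial) • ((A ^ k) (A u)).toLp 2 volume) σ := by
        simp only [Finset.sum_range_succ', hpow, pow_zero]
        have hk : ∀ k : ℕ, HasDerivAt (fun τ : ℝ => τ ^ (k + 1) / ((k + 1).factorial : ℝ))
            (σ ^ k / k.factorial) σ := by
          intro k
          refine ((hasDerivAt_pow (k + 1) σ).div_const _).congr_deriv ?_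
          have := Nat.factorial_pos k
          rw [Nat.factorial_succ]
          push_cast
          field_simp
        exact (HasDerivAt.fun_sum fun k _ =>
          (hk k).smul_const (((A ^ k) (A u)).toLp 2 volume)).add_const _
      exact h1.sub h2
    have hR0 : R 0 = 0 := by
      simp [hR, Finset.sum_range_succ', hS.map_zero]
    have h3 := Convex.norm_image_sub_le_of_norm_hasDerivWithin_le (f := R) (s := Set.Icc (0 : ℝ) 1)
      (C := ‖((A ^ m) (A u)).toLp 2 volume‖) (x := 0) (y := τ) (fun σ _ => (hd σ).hasDerivWithinAt)
      (fun σ hσ => ih (A u) hσ) (convex_Icc 0 1) (by simp) hτ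
    rw [hR0, sub_zero, sub_zero, Real.norm_of_nonneg hτ.1] at h3
    rw [hpow]
    exact h3.trans (mul_le_of_le_one_right (norm_nonneg _) hτ.2)

/-- Taylor expansion of `e^A` on Schwartz functions. -/
theorem IsExp.norm_sub_expPoly_le {A : Op n} {U : L2 n ≃ₗᵢ[ℂ] L2 n}
    (hU : IsExp (fun v => ⇑(A v)) U) (m : ℕ) (u : 𝓢(Space n, ℂ)) :
    ‖U (u.toLp 2 volume) - (expPoly A m u).toLp 2 volume‖ ≤ ‖((A ^ m) u).toLp 2 volume‖ := by
  obtain ⟨S, hS, hgen, rfl⟩ := hU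
  have hA : ∀ u : 𝓢(Space n, ℂ), HasDerivAt (fun τ => S τ (u.toLp 2 volume)) ((A u).toLp 2 volume) 0 := by
    intro u
    obtain ⟨g, hg, hd⟩ := hgen u
    have : g = (A u).toLp 2 volume := Lp.ext (hg.trans (coeFn_toLp _ _ _).symm)
    rwa [← this]
  have h := hS.norm_sub_taylor_le hA m u (τ := 1) (by simp)
  have h2 : (expPoly A m u).toLp 2 volume
      = ∑ k ∈ Finset.range m, ((1 : ℝ) ^ k / k.factorial) • ((A ^ k) u).toLp 2 volume := by
    rw [expPoly, ← toLpCLM_apply (𝕜 := ℂ), map_sum]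
    refine Finset.sum_congr rfl fun k _ => ?_
    rw [map_smul, toLpCLM_apply, RCLike.real_smul_eq_coe_smul (K := ℂ)]
    simp
  rwa [h2]

end Taylor

/-! ### Calculus of orders in the step size. -/

section Orders

variable {n : ℕ} {α : Type*} {h : α → ℝ}

/-- The family `v` of Schwartz functions is `O(hᵏ)`: each of its images in `L²` under a continuous
linear map is. -/
def IsOrder (h : α → ℝ) (k : ℕ) (v : α → 𝓢(Space n, ℂ)) : Prop :=
  ∀ G : 𝓢(Space n, ℂ) →L[ℂ] L2 n, ∃ K, 0 ≤ K ∧ ∀ a, ‖G (v a)‖ ≤ K * h a ^ k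

/-- The family `A` of operators is `O(hʲ)`. -/
def IsOpOrder (h : α → ℝ) (j : ℕ) (A : α → Op n) : Prop :=
  ∀ (k : ℕ) (v : α → 𝓢(Space n, ℂ)), IsOrder h k v → IsOrder h (k + j) fun a => A a (v a)

theorem isOrder_const (u : 𝓢(Space n, ℂ)) : IsOrder h 0 fun _ => u := fun G =>
  ⟨‖G u‖, norm_nonneg _, fun a => by simp⟩

theorem IsOrder.mono (hh : ∀ a, 0 < h a ∧ h a < 1) {k m : ℕ} (hkm : k ≤ m)
    {v : α → 𝓢(Space n, ℂ)} (hv : IsOrder h m v) : IsOrder h k v := fun G => by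
  obtain ⟨K, hK, hb⟩ := hv G
  refine ⟨K, hK, fun a => (hb a).trans ?_⟩
  exact mul_le_mul_of_nonneg_left (pow_le_pow_of_le_one (hh a).1.le (hh a).2.le hkm) hK

theorem IsOrder.congr {k : ℕ} {v w : α → 𝓢(Space n, ℂ)} (hv : IsOrder h k v)
    (hvw : ∀ a, w a = v a) : IsOrder h k w := (funext hvw : w = v) ▸ hv

theorem IsOrder.add {k : ℕ} {v w : α → 𝓢(Space n, ℂ)} (hv : IsOrder h k v) (hw : IsOrder h k w) :
    IsOrder h k fun a => v a + w a := fun G => by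
  obtain ⟨K, hK, hb⟩ := hv G
  obtain ⟨K', hK', hb'⟩ := hw G
  refine ⟨K + K', by positivity, fun a => ?_⟩
  rw [map_add, add_mul]
  exact norm_add_le_of_le (hb a) (hb' a)

theorem IsOrder.smul {j k : ℕ} {c : α → ℂ} {K : ℝ} (hh : ∀ a, 0 < h a ∧ h a < 1)
    (hc : ∀ a, ‖c a‖ ≤ K * h a ^ j)
    {v : α → 𝓢(Space n, ℂ)} (hv : IsOrder h k v) : IsOrder h (k + j) fun a => c a • v a :=
  fun G => by
  obtain ⟨K', hK', hb⟩ := hv G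
  refine ⟨|K| * K', by positivity, fun a => ?_⟩
  have hpos := (hh a).1
  rw [map_smul, norm_smul]
  calc ‖c a‖ * ‖G (v a)‖ ≤ (|K| * h a ^ j) * (K' * h a ^ k) := by
        gcongr
        · exact (hc a).trans (by gcongr; exact le_abs_self K)
        · exact hb a
    _ = _ := by ring

theorem IsOrder.const_smul {k : ℕ} (c : ℂ) {v : α → 𝓢(Space n, ℂ)} (hv : IsOrder h k v) :
    IsOrder h k fun a => c • v a := fun G => by
  obtain ⟨K', hK', hb⟩ := hv G
  refine ⟨‖c‖ * K', by positivity, fun a => ?_⟩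
  rw [map_smul, norm_smul, mul_assoc]
  exact mul_le_mul_of_nonneg_left (hb a) (norm_nonneg _)

theorem IsOrder.sum {ι : Type*} {k : ℕ} (s : Finset ι) {v : ι → α → 𝓢(Space n, ℂ)}
    (hv : ∀ i ∈ s, IsOrder h k (v i)) :
    IsOrder h k fun a => ∑ i ∈ s, v i a := by
  classical
  induction s using Finset.induction_on with
  | empty => exact fun G => ⟨0, le_rfl, fun a => by simp⟩
  | insert i s hi ih =>
    simp only [Finset.sum_insert hi]
    exact (hv i (by simp)).add (ih fun j hj => hv j (by simp [hj]))

/-- This is why `IsOrder` quantifies over all continuous linear `G`: a fixed operator is absorbed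
into `G`, and no Schwartz seminorm has to be estimated. -/
theorem isOpOrder_const (L : Op n) : IsOpOrder h 0 fun _ => L := fun _ _ hv G => hv (G.comp L)

theorem IsOpOrder.add {j : ℕ} {A B : α → Op n} (hA : IsOpOrder h j A) (hB : IsOpOrder h j B) :
    IsOpOrder h j fun a => A a + B a := fun k v hv => (hA k v hv).add (hB k v hv)

theorem IsOpOrder.smul {i j : ℕ} {A : α → Op n} {c : α → ℂ} {K : ℝ}
    (hh : ∀ a, 0 < h a ∧ h a < 1) (hA : IsOpOrder h i A) (hc : ∀ a, ‖c a‖ ≤ K * h a ^ j) :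
    IsOpOrder h (i + j) fun a => c a • A a := fun k v hv => by
  rw [← add_assoc]
  exact (hA k v hv).smul hh hc

theorem IsOpOrder.mono (hh : ∀ a, 0 < h a ∧ h a < 1) {j m : ℕ} (hjm : j ≤ m) {A : α → Op n}
    (hA : IsOpOrder h m A) : IsOpOrder h j A := fun k v hv =>
  (hA k v hv).mono hh (by omega)

theorem IsOpOrder.pow {j : ℕ} {A : α → Op n} (hA : IsOpOrder h j A) (m k : ℕ)
    {v : α → 𝓢(Space n, ℂ)} (hv : IsOrder h k v) :
    IsOrder h (k + m * j) fun a => (A a ^ m) (v a) := by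
  induction m with
  | zero => simpa using hv
  | succ m ih =>
    have := hA _ _ ih
    simp only [pow_succ', Nat.succ_mul, ← add_assoc]
    exact this

/-- A linear family of operators is as small as its argument. -/
theorem isOpOrder_of_linear {j : ℕ} {F : Space n → Op n} (hadd : ∀ a b, F (a + b) = F a + F b)
    (hsmul : ∀ (c : ℝ) a, F (c • a) = (c : ℂ) • F a) (hh : ∀ a, 0 < h a ∧ h a < 1)
    {d : α → Space n} {K : ℝ} (hd : ∀ a, ‖d a‖ ≤ K * h a ^ j) :
    IsOpOrder h j fun a => F (d a) := by
  set b := EuclideanSpace.basisFun (Fin n) ℝ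
  have hF : ∀ x, F x = ∑ i, ((x i : ℝ) : ℂ) • F (b i) := by
    intro x
    have := map_sum (AddMonoidHom.mk' F hadd) (fun i => b.repr x i • b i) Finset.univ
    rw [b.sum_repr] at this
    refine this.trans (Finset.sum_congr rfl fun i _ => ?_)
    rw [AddMonoidHom.mk'_apply, hsmul]
    simp [b]
  intro k v hv
  have : (fun a => F (d a) (v a)) = fun a => ∑ i, ((d a i : ℝ) : ℂ) • F (b i) (v a) := by
    funext a
    rw [hF]
    simp
  rw [this]
  -- In coordinates the family is a finite combination of fixed operators, with scalar coefficients
  -- bounded by `‖d a‖`.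
  refine IsOrder.sum _ fun i _ => ?_
  refine IsOrder.smul hh (K := K) (fun a => ?_) (isOpOrder_const (F (b i)) k v hv)
  rw [Complex.norm_real]
  exact (PiLp.norm_apply_le (d a) i).trans (hd a)

end Orders

/-! ### The Strang splitting for `B = O(h)` and `C = O(h⁵)`. -/

section Strang

variable {n : ℕ} {α : Type*} {h : α → ℝ} {B C : α → Op n}

/-- Every word in the difference contains at least one `C`. The induction uses `Xᵐ⁺¹ - Bᵐ⁺¹ = X(Xᵐ -
Bᵐ) + C Bᵐ` with `X = B + C`. -/
theorem isOrder_add_pow_sub_pow (hh : ∀ a, 0 < h a ∧ h a < 1) (hB : IsOpOrder h 1 B)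
    (hC : IsOpOrder h 5 C) (u : 𝓢(Space n, ℂ)) (k : ℕ) :
    IsOrder h (k + 5) fun a => ((B a + C a) ^ (k + 1)) u - (B a ^ (k + 1)) u := by
  have hBC : IsOpOrder h 1 fun a => B a + C a := hB.add (hC.mono hh (by norm_num))
  induction k with
  | zero => simpa using hC 0 _ (isOrder_const u)
  | succ k ih =>
    have h1 := hBC _ _ ih
    have h2 := hC _ _ (hB.pow (k + 1) 0 (isOrder_const u))
    have h3 : IsOrder h (k + 1 + 5) fun a => C a ((B a ^ (k + 1)) u) :=
      h2.mono hh (by omega)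
    have h4 : IsOrder h (k + 1 + 5) fun a =>
        (B a + C a) (((B a + C a) ^ (k + 1)) u - (B a ^ (k + 1)) u) := h1.mono hh (by omega)
    refine (h4.add h3).congr fun a => ?_
    rw [pow_succ' (B a + C a) (k + 1), pow_succ' (B a) (k + 1), op_mul_apply, op_mul_apply, map_sub,
      add_apply (f := B a) (g := C a) (x := (B a ^ (k + 1)) u)]
    abel

/-- The Taylor polynomial of `e^B (1 + C / 2) u`, up to terms that are negligible in the Strang
splitting. -/
noncomputable def strangPoly (B C : Op n) (u : 𝓢(Space n, ℂ)) : 𝓢(Space n, ℂ) :=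
  expPoly B 7 u + expPoly B 2 (((1 / 2 : ℂ) • C) u)

theorem expPoly_two (A : Op n) (u : 𝓢(Space n, ℂ)) : expPoly A 2 u = u + A u := by
  simp [expPoly, Finset.sum_range_succ]

theorem strangPoly_sub_eq (B C : Op n) (u : 𝓢(Space n, ℂ)) : strangPoly B C u - (u + B u) =
    (∑ k ∈ Finset.range 5, (((k + 2).factorial : ℂ)⁻¹) • (B ^ (k + 2)) u)
      + (((1 / 2 : ℂ) • C) u + B (((1 / 2 : ℂ) • C) u)) := by
  rw [strangPoly, expPoly_two, expPoly, Finset.sum_range_succ', Finset.sum_range_succ']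
  simp
  abel

/-- The symmetric placement of `C / 2` makes the terms `C` and `(BC + CB) / 2` cancel. The rest is
visibly small: powers of degree at least three, a term `C²`, and `C` applied to a part of
`strangPoly` that is `O(h²)`. -/
theorem expPoly_sub_strangPoly_eq (B C : Op n) (u : 𝓢(Space n, ℂ)) :
    expPoly (B + C) 7 u - expPoly ((1 / 2 : ℂ) • C) 2 (strangPoly B C u) =
      (∑ k ∈ Finset.range 4, (((k + 3).factorial : ℂ)⁻¹) •
        (((B + C) ^ (k + 3)) u - (B ^ (k + 3)) u))
      + C (((1 / 2 : ℂ) • C) u) + (-1 / 2 : ℂ) • C (strangPoly B C u - (u + B u)) := by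
  have h1 : ∀ A : Op n, expPoly A 7 u = u + A u + (1 / 2 : ℂ) • A (A u)
      + ∑ k ∈ Finset.range 4, (((k + 3).factorial : ℂ)⁻¹) • (A ^ (k + 3)) u := by
    intro A
    rw [expPoly, Finset.sum_range_succ', Finset.sum_range_succ', Finset.sum_range_succ']
    simp [Nat.factorial, pow_two]
    abel
  have h2 : strangPoly B C u = u + B u + (1 / 2 : ℂ) • B (B u)
      + (∑ k ∈ Finset.range 4, (((k + 3).factorial : ℂ)⁻¹) • (B ^ (k + 3)) u)
      + (1 / 2 : ℂ) • (C u + B (C u)) := by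
    rw [strangPoly, expPoly_two, h1]
    simp
  rw [expPoly_two, h1, map_sub, map_add]
  simp only [smul_sub, Finset.sum_sub_distrib, smul_apply]
  generalize C (strangPoly B C u) = y
  rw [h2]
  simp
  module

theorem isOrder_strangPoly_sub (hh : ∀ a, 0 < h a ∧ h a < 1) (hB : IsOpOrder h 1 B)
    (hC : IsOpOrder h 5 C) (u : 𝓢(Space n, ℂ)) :
    IsOrder h 2 fun a => strangPoly (B a) (C a) u - (u + B a u) := by
  have hC2 : IsOpOrder h 5 fun a => (1 / 2 : ℂ) • C a := fun k v hv => (hC k v hv).const_smul _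
  have hu := isOrder_const (h := h) u
  have hCu := hC2 0 _ hu
  have hBCu := hB _ _ hCu
  refine ((IsOrder.sum (Finset.range 5) fun k _ => ?_).add
    ((hCu.mono hh (by omega)).add (hBCu.mono hh (by omega)))).congr
    fun a => strangPoly_sub_eq (B a) (C a) u
  exact ((hB.pow (k + 2) 0 hu).mono hh (by omega)).const_smul _

theorem isOrder_strangPoly (hh : ∀ a, 0 < h a ∧ h a < 1) (hB : IsOpOrder h 1 B)
    (hC : IsOpOrder h 5 C) (u : 𝓢(Space n, ℂ)) :
    IsOrder h 0 fun a => strangPoly (B a) (C a) u := by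
  have hu := isOrder_const (h := h) u
  exact (((isOrder_strangPoly_sub hh hB hC u).mono hh (by omega)).add
    (hu.add ((hB 0 _ hu).mono hh (by omega)))).congr fun a => (sub_add_cancel _ _).symm

theorem isOrder_expPoly_sub_strangPoly (hh : ∀ a, 0 < h a ∧ h a < 1) (hB : IsOpOrder h 1 B)
    (hC : IsOpOrder h 5 C) (u : 𝓢(Space n, ℂ)) :
    IsOrder h 7 fun a => expPoly (B a + C a) 7 u
      - expPoly ((1 / 2 : ℂ) • C a) 2 (strangPoly (B a) (C a) u) := by
  have hC2 : IsOpOrder h 5 fun a => (1 / 2 : ℂ) • C a := fun k v hv => (hC k v hv).const_smul _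
  have h1 := hC _ _ (hC2 0 _ (isOrder_const u))
  have h2 := hC _ _ (isOrder_strangPoly_sub hh hB hC u)
  refine (((IsOrder.sum (Finset.range 4) fun k _ => ?_).add (h1.mono hh (by omega))).add
    ((h2.mono hh (by omega)).const_smul _)).congr fun a => expPoly_sub_strangPoly_eq (B a) (C a) u
  exact ((isOrder_add_pow_sub_pow hh hB hC u (k + 2)).mono hh (by omega)).const_smul _

/-- The error of the Strang splitting, in terms of the errors of Taylor polynomials. -/
theorem norm_sub_strang_le {H : Type*} [NormedAddCommGroup H] [NormedSpace ℂ H]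
    (EΘ EB EC : H ≃ₗᵢ[ℂ] H) {u p w v b b' : H} {k₁ k₂ k₃ k₄ k₅ k₆ : ℝ} (h1 : ‖EΘ u - p‖ ≤ k₁)
    (h2 : ‖p - w‖ ≤ k₂) (h3 : ‖EC (b + b') - w‖ ≤ k₃) (h4 : ‖EB u - b‖ ≤ k₄)
    (h5 : ‖EB v - b'‖ ≤ k₅) (h6 : ‖EC u - (u + v)‖ ≤ k₆) :
    ‖EΘ u - EC (EB (EC u))‖ ≤ k₁ + k₂ + k₃ + k₄ + k₅ + k₆ := by
  -- The errors telescope, and the isometries `EB`, `EC` carry the inner ones outward without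
  -- enlarging them.
  have key : EΘ u - EC (EB (EC u)) = (EΘ u - p) + (p - w) - (EC (b + b') - w) - EC (EB u - b)
      - EC (EB v - b') - EC (EB (EC u - (u + v))) := by
    simp only [map_sub, map_add]
    abel
  rw [← EC.norm_map] at h4 h5
  rw [← EB.norm_map, ← EC.norm_map] at h6
  rw [key]
  exact norm_sub_le_of_le (norm_sub_le_of_le (norm_sub_le_of_le (norm_sub_le_of_le
    (norm_add_le_of_le h1 h2) h3) h4) h5) h6

/-- Truncation degrees are matched to the orders: degree `7` for the exponentials of `B + C` and `B`
on `u`, degree `2` for `B` on `C u / 2` (order `5 + 2`), and degree `2` for `C / 2` (order `10`). -/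
theorem strang_splitting (hh : ∀ a, 0 < h a ∧ h a < 1) (hB : IsOpOrder h 1 B)
    (hC : IsOpOrder h 5 C) (u : 𝓢(Space n, ℂ)) :
    ∃ K, ∀ a, ∀ EΘ EB EC : L2 n ≃ₗᵢ[ℂ] L2 n,
      IsExp (fun v => ⇑((B a + C a) v)) EΘ → IsExp (fun v => ⇑(B a v)) EB →
      IsExp (fun v => ⇑(((1 / 2 : ℂ) • C a) v)) EC →
      ‖EΘ (u.toLp 2 volume) - EC (EB (EC (u.toLp 2 volume)))‖ ≤ K * h a ^ 7 := by
  have hBC : IsOpOrder h 1 fun a => B a + C a := hB.add (hC.mono hh (by norm_num))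
  have hC2 : IsOpOrder h 5 fun a => (1 / 2 : ℂ) • C a := fun k v hv => (hC k v hv).const_smul _
  have hu := isOrder_const (h := h) u
  set G : 𝓢(Space n, ℂ) →L[ℂ] L2 n := toLpCLM ℂ ℂ 2 volume
  obtain ⟨K1, -, hK1⟩ := hBC.pow 7 0 hu G
  obtain ⟨K2, -, hK2⟩ := isOrder_expPoly_sub_strangPoly hh hB hC u G
  obtain ⟨K3, -, hK3⟩ := (hC2.pow 2 0 (isOrder_strangPoly hh hB hC u)).mono hh
    (show 7 ≤ _ by norm_num) G
  obtain ⟨K4, -, hK4⟩ := hB.pow 7 0 hu G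
  obtain ⟨K5, -, hK5⟩ := hB.pow 2 _ (hC2 0 _ hu) G
  obtain ⟨K6, -, hK6⟩ := (hC2.pow 2 0 hu).mono hh (show 7 ≤ _ by norm_num) G
  refine ⟨K1 + K2 + K3 + K4 + K5 + K6, fun a EΘ EB EC hΘ hEB hEC => ?_⟩
  have b1 := (hΘ.norm_sub_expPoly_le 7 u).trans (hK1 a)
  have b2 : ‖G (expPoly (B a + C a) 7 u)
      - G (expPoly ((1 / 2 : ℂ) • C a) 2 (strangPoly (B a) (C a) u))‖ ≤ K2 * h a ^ 7 := by
    rw [← map_sub]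
    exact hK2 a
  have b3 : ‖EC (G (expPoly (B a) 7 u) + G (expPoly (B a) 2 (((1 / 2 : ℂ) • C a) u)))
      - G (expPoly ((1 / 2 : ℂ) • C a) 2 (strangPoly (B a) (C a) u))‖ ≤ K3 * h a ^ 7 := by
    rw [← map_add G]
    exact (hEC.norm_sub_expPoly_le 2 (strangPoly (B a) (C a) u)).trans (hK3 a)
  have b4 := (hEB.norm_sub_expPoly_le 7 u).trans (hK4 a)
  have b5 := (hEB.norm_sub_expPoly_le 2 (((1 / 2 : ℂ) • C a) u)).trans (hK5 a)
  have b6 : ‖EC (G u) - (G u + G (((1 / 2 : ℂ) • C a) u))‖ ≤ K6 * h a ^ 7 := by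
    rw [← map_add G, ← expPoly_two]
    exact (hEC.norm_sub_expPoly_le 2 u).trans (hK6 a)
  refine (norm_sub_strang_le EΘ EB EC b1 b2 b3 b4 b5 b6).trans_eq ?_
  ring

end Strang

/-! ### Orders of `T₁`, `W₁` and `C₁`. -/

section Main

variable {n : ℕ} {α : Type*} {h t : α → ℝ} {ε M L : ℝ} {V₀ : Space n → ℝ} {e : ℝ → Space n}

theorem W1_eq (hV₀ : V₀.HasTemperateGrowth) (ε : ℝ) (e : ℝ → Space n) (t h : ℝ) :
    W1 ε V₀ e t h = (-(Complex.I * h * (ε : ℂ)⁻¹)) •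
        (mulOp (fun x => (V₀ x : ℂ)) + linOp (rVec e t h))
      + (Complex.I * (ε : ℂ)⁻¹) • gradOp V₀ (qVec e t h) + cScalar ε e t h • 1 := by
  ext u x
  rw [W1_apply hV₀]
  simp [mulOp_apply (hasTemperateGrowth_ofReal hV₀), linOp_apply, gradOp_apply hV₀]
  ring

theorem isOpOrder_T1 (hh : ∀ a, 0 < h a ∧ h a < 1)
    (hM : ∀ a ζ, 0 ≤ ζ → ζ ≤ h a → ‖e (t a + ζ)‖ ≤ M) :
    IsOpOrder h 1 fun a => T1 ε e (t a) (h a) := by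
  have h1 : IsOpOrder h 1 fun a => (Complex.I * (h a : ℂ) * (ε : ℂ)) • (lap : Op n) := by
    refine (isOpOrder_const lap).smul hh (j := 1) (K := |ε|) fun a => ?_
    simp [abs_of_pos (hh a).1, mul_comm]
  have h2 : IsOpOrder h 1 fun a => dirDeriv ((-1 : ℝ) • sVec e (t a) (h a)) := by
    refine isOpOrder_of_linear dirDeriv_add dirDeriv_smul hh (K := 6 * M) fun a => ?_
    have hb := norm_mu_le (k := 1) (by norm_num) (hh a).1 (hM a)
    have hM0 : 0 ≤ M := (norm_nonneg _).trans (hM a 0 le_rfl (hh a).1.le)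
    have hle : h a ^ (1 + 1) ≤ h a ^ 1 := pow_le_pow_of_le_one (hh a).1.le (hh a).2.le (by omega)
    rw [sVec, norm_smul, norm_smul]
    norm_num at hb hle ⊢
    nlinarith [mul_le_mul_of_nonneg_left hle hM0]
  have h3 : ∀ a, T1 ε e (t a) (h a) = (Complex.I * (h a : ℂ) * (ε : ℂ)) • lap
      + dirDeriv ((-1 : ℝ) • sVec e (t a) (h a)) := fun a => by
    rw [T1, dirDeriv_smul, sub_eq_add_neg]
    simp
  simp only [h3]
  exact h1.add h2

theorem isOpOrder_W1 (hε : 0 < ε) (hV₀ : V₀.HasTemperateGrowth) (hh : ∀ a, 0 < h a ∧ h a < 1)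
    (hM : ∀ a ζ, 0 ≤ ζ → ζ ≤ h a → ‖e (t a + ζ)‖ ≤ M) :
    IsOpOrder h 1 fun a => W1 ε V₀ e (t a) (h a) := by
  simp only [W1_eq hV₀]
  have h1 : IsOpOrder h 0 fun a => linOp (rVec e (t a) (h a)) := by
    refine isOpOrder_of_linear linOp_add linOp_smul hh (K := 3 * M) fun a => ?_
    have hb := norm_mu_le (k := 0) (by norm_num) (hh a).1 (hM a)
    have hpos := (hh a).1
    rw [rVec, norm_smul, norm_inv, Real.norm_of_nonneg hpos.le, inv_mul_le_iff₀ hpos]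
    refine hb.trans_eq (by ring)
  have h2 : IsOpOrder h 1 fun a => gradOp V₀ (qVec e (t a) (h a)) := by
    refine isOpOrder_of_linear (gradOp_add hV₀) (gradOp_smul hV₀) hh (K := 3 * M) fun a => ?_
    have hb := norm_mu_le (k := 2) (by norm_num) (hh a).1 (hM a)
    have hM0 : 0 ≤ M := (norm_nonneg _).trans (hM a 0 le_rfl (hh a).1.le)
    refine hb.trans ?_
    have hle := pow_le_pow_of_le_one (hh a).1.le (hh a).2.le (show 1 ≤ 2 + 1 by omega)
    exact mul_le_mul_of_nonneg_left hle (by positivity)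
  refine IsOpOrder.add (IsOpOrder.add ?_ ?_) ?_
  · refine IsOpOrder.smul hh ((isOpOrder_const (mulOp fun x => (V₀ x : ℂ))).add h1) (j := 1)
      (K := ε⁻¹) fun a => ?_
    simp [abs_of_pos (hh a).1, abs_of_pos hε, mul_comm]
  · refine IsOpOrder.smul hh h2 (j := 0) (K := ε⁻¹) fun a => ?_
    simp [abs_of_pos hε]
  · refine IsOpOrder.smul hh (isOpOrder_const 1) (j := 1) (K := 4 * ε⁻¹ * M ^ 2) fun a => ?_
    rw [pow_one]
    exact norm_cScalar_le hε (hh a).1 (hh a).2 (hM a)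

theorem isOpOrder_C1 (hV₀ : V₀.HasTemperateGrowth) (he : Continuous e)
    (hh : ∀ a, 0 < h a ∧ h a < 1)
    (hL : ∀ a ζ, 0 ≤ ζ → ζ ≤ h a → ‖e (t a + ζ) - e (t a)‖ ≤ L * ζ) :
    IsOpOrder h 5 fun a => C1 V₀ e (t a) (h a) := by
  refine isOpOrder_of_linear (F := fun d => ⁅(lap : Op n), gradOp V₀ d⁆)
    (d := fun a => pVec e (t a) (h a)) (K := L) (fun a b => ?_) (fun c a => ?_) hh fun a => ?_
  · rw [gradOp_add hV₀]
    simp only [Ring.lie_def, mul_add, add_mul]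
    abel
  · rw [gradOp_smul hV₀]
    simp only [Ring.lie_def, mul_smul_comm, smul_mul_assoc]
    module
  · have hb := norm_mu_three_le he (hh a).1 (hL a)
    rw [pVec, norm_smul]
    norm_num
    linarith

end Main

end LaserMagnus

theorem mainTheorem3 {n : ℕ} (ε : ℝ) (hε : 0 < ε)
    (V₀ : LaserMagnus.Space n → ℝ) (hV₀ : V₀.HasTemperateGrowth)
    (e : ℝ → LaserMagnus.Space n) (he : ContDiffOn ℝ 1 e (Set.Ici 0)) :
    -- the Magnus expansion is `Θ₄ = T₁ + W₁ + C₁`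
    (∀ t : ℝ, 0 ≤ t → ∀ h : ℝ, 0 < h →
      ∀ (u : 𝓢(LaserMagnus.Space n, ℂ)) (x : LaserMagnus.Space n),
        LaserMagnus.Theta4 (LaserMagnus.schrOp ε V₀ e) t h u x =
          ((LaserMagnus.T1 ε e t h + LaserMagnus.W1 ε V₀ e t h
            + LaserMagnus.C1 V₀ e t h) u) x) ∧
    ∀ (u : 𝓢(LaserMagnus.Space n, ℂ)) (T : ℝ), ∃ K h₀ : ℝ, 0 < h₀ ∧
      ∀ t ∈ Set.Icc 0 T, ∀ h ∈ Set.Ioo 0 h₀,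
        -- `C₁ = O(h⁵)`
        ‖(LaserMagnus.C1 V₀ e t h u).toLp 2‖ ≤ K * h ^ 5 ∧
        -- `e^{Θ₄} = e^{C₁/2} e^{T₁+W₁} e^{C₁/2} + O(h⁷)`
        ∀ EΘ EB EC : LaserMagnus.L2 n ≃ₗᵢ[ℂ] LaserMagnus.L2 n,
          LaserMagnus.IsExp (LaserMagnus.Theta4 (LaserMagnus.schrOp ε V₀ e) t h) EΘ →
          LaserMagnus.IsExp
            (fun v => ⇑((LaserMagnus.T1 ε e t h + LaserMagnus.W1 ε V₀ e t h) v)) EB →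
          LaserMagnus.IsExp (fun v => ⇑(((1 / 2 : ℂ) • LaserMagnus.C1 V₀ e t h) v)) EC →
            ‖EΘ (u.toLp 2) - EC (EB (EC (u.toLp 2)))‖ ≤ K * h ^ 7 := by
  open LaserMagnus in
  -- Freezing `e` at negative times gives a field continuous on all of `ℝ`, as the moment lemmas
  -- require.
  set e' : ℝ → Space n := fun τ => e (max τ 0) with he'_def
  have hee' : ∀ τ, 0 ≤ τ → e τ = e' τ := fun τ hτ => by rw [he'_def]; simp [max_eq_left hτ]
  have he' : Continuous e' :=
    he.continuousOn.comp_continuous (by fun_prop) fun τ => le_max_right τ 0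
  have hΘ : ∀ t : ℝ, 0 ≤ t → ∀ h : ℝ, 0 < h → ∀ (u : 𝓢(Space n, ℂ)) (x : Space n),
      Theta4 (schrOp ε V₀ e) t h u x
        = ((T1 ε e t h + W1 ε V₀ e t h + C1 V₀ e t h) u) x := by
    intro t ht h hh u x
    rw [Theta4_congr (A' := schrOp ε V₀ e') (fun τ hτ => by rw [schrOp, schrOp, hee' τ hτ]) ht hh.le,
      Theta4_eq hε.ne' hV₀ he' hh.ne', T1_congr hee' ht hh.le, W1_congr hee' ht hh.le,
      C1_congr hee' ht hh.le]
  refine ⟨hΘ, fun u T => ?_⟩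
  -- Indexing the families by pairs `(t, h)` makes all constants uniform in `t`. Since `h < 1`, only
  -- times in `[0, T + 1]` matter.
  let α := {p : ℝ × ℝ // p.1 ∈ Set.Icc 0 T ∧ p.2 ∈ Set.Ioo (0 : ℝ) 1}
  let τ : α → ℝ := fun a => a.1.1
  let η : α → ℝ := fun a => a.1.2
  have hη : ∀ a, 0 < η a ∧ η a < 1 := fun a => a.2.2
  have hmem : ∀ (a : α) (ζ : ℝ), 0 ≤ ζ → ζ ≤ η a → τ a + ζ ∈ Set.Icc 0 (T + 1) := fun a ζ h0 h1 =>
    ⟨add_nonneg a.2.1.1 h0, add_le_add a.2.1.2 (h1.trans (hη a).2.le)⟩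
  have hsub : Set.Icc 0 (T + 1) ⊆ Set.Ici (0 : ℝ) := Set.Icc_subset_Ici_self
  obtain ⟨M, hM⟩ := isCompact_Icc.exists_bound_of_continuousOn
    (he.continuousOn.mono hsub)
  obtain ⟨L, hL⟩ : ∃ L : NNReal, LipschitzOnWith L e (Set.Icc 0 (T + 1)) :=
    LocallyLipschitzOn.exists_lipschitzOnWith_of_compact isCompact_Icc fun _ hx =>
      ((he.mono hsub) _ hx).exists_lipschitzOnWith (convex_Icc _ _)
  have hM' : ∀ (a : α) ζ, 0 ≤ ζ → ζ ≤ η a → ‖e' (τ a + ζ)‖ ≤ M := fun a ζ h0 h1 => by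
    rw [← hee' _ (hmem a ζ h0 h1).1]
    exact hM _ (hmem a ζ h0 h1)
  have hL' : ∀ (a : α) ζ, 0 ≤ ζ → ζ ≤ η a → ‖e' (τ a + ζ) - e' (τ a)‖ ≤ L * ζ := fun a ζ h0 h1 => by
    have hτ := hmem a 0 le_rfl (hη a).1.le
    rw [add_zero] at hτ
    rw [← hee' _ (hmem a ζ h0 h1).1, ← hee' _ hτ.1]
    simpa [abs_of_nonneg h0] using hL.norm_sub_le (hmem a ζ h0 h1) hτ
  have hB : IsOpOrder η 1 fun a => T1 ε e' (τ a) (η a) + W1 ε V₀ e' (τ a) (η a) :=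
    (isOpOrder_T1 hη hM').add (isOpOrder_W1 hε hV₀ hη hM')
  have hC := isOpOrder_C1 hV₀ he' hη hL'
  obtain ⟨K₁, hK₁, hCb⟩ := hC 0 _ (isOrder_const u) (toLpCLM ℂ ℂ 2 volume)
  obtain ⟨K₂, hK₂⟩ := strang_splitting hη hB hC u
  refine ⟨max K₁ K₂, 1, one_pos, fun t ht h hh => ?_⟩
  have hT := T1_congr hee' ht.1 hh.1.le ε
  have hW := W1_congr hee' ht.1 hh.1.le ε V₀
  have hC1 := C1_congr hee' ht.1 hh.1.le V₀
  have hpos := hh.1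
  refine ⟨?_, fun EΘ EB EC hEΘ hEB hEC => ?_⟩
  · rw [hC1]
    refine (hCb ⟨(t, h), ht, hh⟩).trans ?_
    rw [zero_add]
    change K₁ * h ^ 5 ≤ _
    gcongr
    exact le_max_left _ _
  -- By the first part, `EΘ` is an exponential of `B + C`, as `strang_splitting` needs.
  · rw [show Theta4 (schrOp ε V₀ e) t h = fun v => ⇑((T1 ε e t h + W1 ε V₀ e t h + C1 V₀ e t h) v)
      from funext fun v => funext fun x => hΘ t ht.1 h hh.1 v x] at hEΘ
    rw [hT, hW, hC1] at hEΘ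
    rw [hT, hW] at hEB
    rw [hC1] at hEC
    refine (hK₂ ⟨(t, h), ht, hh⟩ EΘ EB EC hEΘ hEB hEC).trans ?_
    change K₂ * h ^ 7 ≤ _
    gcongr
    exact le_max_right _ _
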